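/- Let a binary sextic be a homogeneous polynomial of degree $6$ in $\mathbb C[x,y]$. For a binary sextic $p$, let $N(p)$ be the number of different unordered pairs $\{f_1^3,f_2^3\}$, where $f_1,f_2\in\mathbb C[x,y]$ are non-proportional quadratic forms with $p=f_1^3+f_2^3$ (so neither the order of the summands nor cube roots of unity multiplying the $f_i$ matter; the zero form is proportional to every form). Call $f$ and $g$ similar if $g(x,y)=f(\alpha x+\beta y,\gamma x+\delta y)$ for some $\alpha,\beta,\gamma,\delta\in\mathbb C$ with $\alpha\delta-\beta\gamma\ne0$. For $t\in\mathbb C$ put $A_t(x,y)=x^6+t\,x^4y^2+t\,x^2y^4+y^6$. Then a binary sextic $p$ satisfies $N(p)=2$ if and only if $p$ is similar to $A_t$ for some $t\in\mathbb C\setminus\{3,-1,0,15,-5\}$. For the exceptional values of $t$, $N(A_3)=0$, $N(A_{-1})=1$, $N(A_0)=N(A_{15})=4$ and $N(A_{-5})=6$. -/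

import Mathlib

namespace BinaryForm

open MvPolynomial

/-- Binary polynomials over `ℂ`, with `x = X 0` and `y = X 1`. -/
abbrev Poly : Type := MvPolynomial (Fin 2) ℂ

/-- Substitution of an invertible linear change of variables:
`(f ∘ M)(x, y) = f (M₀₀ x + M₀₁ y, M₁₀ x + M₁₁ y)`. -/
noncomputable def comp (f : Poly) (M : Matrix.GeneralLinearGroup (Fin 2) ℂ) : Poly :=
  aeval (fun i : Fin 2 => C ((M : Matrix (Fin 2) (Fin 2) ℂ) i 0) * X 0 +
    C ((M : Matrix (Fin 2) (Fin 2) ℂ) i 1) * X 1) f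

/-- `g` and `f` are similar if `g = f ∘ M` for some invertible linear change `M`. -/
def Similar (g f : Poly) : Prop :=
  ∃ M : Matrix.GeneralLinearGroup (Fin 2) ℂ, g = comp f M

/-- Two forms are distinct if they are not proportional
(the zero form is proportional to every form). -/
def Distinct (f g : Poly) : Prop := LinearIndependent ℂ ![f, g]

/-- The representations of `p` as a sum of the cubes of two distinct binary quadratic forms.
A representation is recorded as the unordered pair of its two cubes, so that neither the order of
the summands nor cube roots of unity multiplying the quadratics matter. -/
def cubeReps (p : Poly) : Set (Sym2 Poly) :=
  {S | ∃ f g : Poly, f.IsHomogeneous 2 ∧ g.IsHomogeneous 2 ∧ Distinct f g ∧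
    p = f ^ 3 + g ^ 3 ∧ S = s(f ^ 3, g ^ 3)}

/-- The number of representations of `p` as a sum of two cubes (possibly infinite a priori). -/
noncomputable def N (p : Poly) : ℕ∞ := (cubeReps p).encard

/-- `A_t = x⁶ + t x⁴ y² + t x² y⁴ + y⁶`. -/
noncomputable def A (t : ℂ) : Poly :=
  X 0 ^ 6 + C t * X 0 ^ 4 * X 1 ^ 2 + C t * X 0 ^ 2 * X 1 ^ 4 + X 1 ^ 6

end BinaryForm

namespace BinaryForm

open MvPolynomial

/-! Over `ℂ` a sum `f³ + g³` splits into three members of the pencil spanned by `f` and `g`, and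
these can be scaled to `a`, `b`, `a + b` up to signs. So a representation of `p` amounts to a plane
of quadratic forms with a basis satisfying `p = a b (a + b)`, and the plane determines the two cubes
(`cubes_eq_iff_span_eq`). Hence `N p` counts planes (`N_eq_encard_planes`), and linear changes of
variables carry planes to planes.

Every plane is equivalent to `⟨x², xy⟩` or `⟨x², y²⟩` (`exists_map_eq_normalForm`). The first kind
is always the only plane of its sextic (`planes_eq_singleton_of_degenerate`), so when `N p = 2` both
planes are of the second kind. The plane `⟨x², y²⟩` is fixed pointwise by `y ↦ -y`, so each plane of
`p` provides an involution preserving `p`. Put one plane at `⟨x², y²⟩`. The involution of the other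
must preserve it, because there are only two planes, and must swap the axes (`exists_antidiagonal`).
An even sextic with such a symmetry becomes palindromic after scaling `y`, which gives `A_t`
(`exists_similar_A_of_N_eq_two`).

To count for `A_t` with `t ≠ 3`, the coordinates `x ± iy` turn it into `xy(x⁴ + k x²y² + y⁴)` with
`k = (10 + 2t)/(3 - t)`. There the equation `p = a b (a + b)` can be solved by comparing
coefficients (`planes_axisSextic_cases`): two planes in general, one if `k = ±2`, four more if `k =
0`, two more if `k = ±10/3`. The remaining `A_3` is equivalent to `(xy)³`, which has no plane. -/

/-! ### Quadratic and sextic forms in coordinates -/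

/-- The exponent of `x ^ i * y ^ j`. -/
noncomputable def expo (i j : ℕ) : Fin 2 →₀ ℕ := Finsupp.single 0 i + Finsupp.single 1 j

lemma expo_apply_zero (i j : ℕ) : expo i j 0 = i := by simp [expo]

lemma expo_apply_one (i j : ℕ) : expo i j 1 = j := by simp [expo]

lemma expo_eq_iff {i j k l : ℕ} : expo i j = expo k l ↔ i = k ∧ j = l := by
  constructor
  · intro h
    have h0 := DFunLike.congr_fun h 0
    have h1 := DFunLike.congr_fun h 1
    simp only [expo_apply_zero, expo_apply_one] at h0 h1
    exact ⟨h0, h1⟩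
  · rintro ⟨rfl, rfl⟩; rfl

lemma eq_expo (m : Fin 2 →₀ ℕ) : m = expo (m 0) (m 1) := by
  ext i
  fin_cases i <;> simp [expo]

lemma coeff_expo (c : ℂ) (i j k l : ℕ) :
    coeff (expo k l) (C c * X 0 ^ i * X 1 ^ j : Poly) = if i = k ∧ j = l then c else 0 := by
  have : (C c * X 0 ^ i * X 1 ^ j : Poly) = monomial (expo i j) c := by
    rw [monomial_eq, expo, Finsupp.prod_add_index' (by simp) (by simp [pow_add])]
    simp [mul_assoc]
  rw [this, coeff_monomial]
  simp only [expo_eq_iff]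

/-- The quadratic form with the given coefficients. -/
noncomputable def quad (a b c : ℂ) : Poly :=
  C a * X 0 ^ 2 * X 1 ^ 0 + C b * X 0 ^ 1 * X 1 ^ 1 + C c * X 0 ^ 0 * X 1 ^ 2

/-- The sextic form with the given coefficients. -/
noncomputable def sextic (c₀ c₁ c₂ c₃ c₄ c₅ c₆ : ℂ) : Poly :=
  C c₀ * X 0 ^ 6 * X 1 ^ 0 + C c₁ * X 0 ^ 5 * X 1 ^ 1 + C c₂ * X 0 ^ 4 * X 1 ^ 2 +
    C c₃ * X 0 ^ 3 * X 1 ^ 3 + C c₄ * X 0 ^ 2 * X 1 ^ 4 + C c₅ * X 0 ^ 1 * X 1 ^ 5 +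
    C c₆ * X 0 ^ 0 * X 1 ^ 6

lemma quad_inj {a b c a' b' c' : ℂ} :
    quad a b c = quad a' b' c' ↔ a = a' ∧ b = b' ∧ c = c' := by
  constructor
  · intro h
    have h0 := congrArg (coeff (expo 2 0)) h
    have h1 := congrArg (coeff (expo 1 1)) h
    have h2 := congrArg (coeff (expo 0 2)) h
    simp only [quad, coeff_add, coeff_expo] at h0 h1 h2
    norm_num at h0 h1 h2
    exact ⟨h0, h1, h2⟩
  · rintro ⟨rfl, rfl, rfl⟩; rfl

lemma sextic_inj {c₀ c₁ c₂ c₃ c₄ c₅ c₆ d₀ d₁ d₂ d₃ d₄ d₅ d₆ : ℂ} :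
    sextic c₀ c₁ c₂ c₃ c₄ c₅ c₆ = sextic d₀ d₁ d₂ d₃ d₄ d₅ d₆ ↔
      c₀ = d₀ ∧ c₁ = d₁ ∧ c₂ = d₂ ∧ c₃ = d₃ ∧ c₄ = d₄ ∧ c₅ = d₅ ∧ c₆ = d₆ := by
  constructor
  · intro h
    have h0 := congrArg (coeff (expo 6 0)) h
    have h1 := congrArg (coeff (expo 5 1)) h
    have h2 := congrArg (coeff (expo 4 2)) h
    have h3 := congrArg (coeff (expo 3 3)) h
    have h4 := congrArg (coeff (expo 2 4)) h
    have h5 := congrArg (coeff (expo 1 5)) h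
    have h6 := congrArg (coeff (expo 0 6)) h
    simp only [sextic, coeff_add, coeff_expo] at h0 h1 h2 h3 h4 h5 h6
    norm_num at h0 h1 h2 h3 h4 h5 h6
    exact ⟨h0, h1, h2, h3, h4, h5, h6⟩
  · rintro ⟨rfl, rfl, rfl, rfl, rfl, rfl, rfl⟩; rfl

lemma isHomogeneous_monomial_form (c : ℂ) (i j : ℕ) :
    (C c * X 0 ^ i * X 1 ^ j : Poly).IsHomogeneous (i + j) := by
  have h := ((isHomogeneous_C (Fin 2) c).mul ((isHomogeneous_X ℂ (0 : Fin 2)).pow i)).mul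
    ((isHomogeneous_X ℂ (1 : Fin 2)).pow j)
  simpa using h

lemma isHomogeneous_quad (a b c : ℂ) : (quad a b c).IsHomogeneous 2 :=
  ((isHomogeneous_monomial_form a 2 0).add (isHomogeneous_monomial_form b 1 1)).add
    (isHomogeneous_monomial_form c 0 2)

lemma exists_eq_quad {f : Poly} (hf : f.IsHomogeneous 2) : ∃ a b c : ℂ, f = quad a b c := by
  refine ⟨coeff (expo 2 0) f, coeff (expo 1 1) f, coeff (expo 0 2) f, ?_⟩
  ext m
  rw [eq_expo m]
  generalize m 0 = i
  generalize m 1 = j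
  by_cases hm : i + j = 2
  · have : i ≤ 2 := by omega
    simp only [quad, coeff_add, coeff_expo]
    interval_cases i
    · obtain rfl : j = 2 := by omega
      simp
    · obtain rfl : j = 1 := by omega
      simp
    · obtain rfl : j = 0 := by omega
      simp
  · have h1 : ∀ g : Poly, g.IsHomogeneous 2 → coeff (expo i j) g = 0 := by
      intro g hg
      refine hg.coeff_eq_zero ?_
      rw [Finsupp.degree_eq_sum, Fin.sum_univ_two, expo_apply_zero, expo_apply_one]
      exact hm
    rw [h1 f hf, h1 _ (isHomogeneous_quad _ _ _)]

lemma quad_add (a b c a' b' c' : ℂ) :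
    quad a b c + quad a' b' c' = quad (a + a') (b + b') (c + c') := by
  simp only [quad, map_add]; ring

lemma smul_quad (r a b c : ℂ) : r • quad a b c = quad (r * a) (r * b) (r * c) := by
  simp only [quad, smul_eq_C_mul, map_mul]; ring

lemma quad_zero : quad 0 0 0 = 0 := by simp [quad]

lemma quad_mul_mul_add (a₀ a₁ a₂ b₀ b₁ b₂ : ℂ) :
    quad a₀ a₁ a₂ * quad b₀ b₁ b₂ * (quad a₀ a₁ a₂ + quad b₀ b₁ b₂) =
      sextic (a₀ * b₀ * (a₀ + b₀))
        (a₀ * b₀ * (a₁ + b₁) + (a₀ * b₁ + a₁ * b₀) * (a₀ + b₀))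
        (a₀ * b₀ * (a₂ + b₂) + (a₀ * b₁ + a₁ * b₀) * (a₁ + b₁) +
          (a₀ * b₂ + a₁ * b₁ + a₂ * b₀) * (a₀ + b₀))
        ((a₀ * b₁ + a₁ * b₀) * (a₂ + b₂) + (a₀ * b₂ + a₁ * b₁ + a₂ * b₀) * (a₁ + b₁) +
          (a₁ * b₂ + a₂ * b₁) * (a₀ + b₀))
        ((a₀ * b₂ + a₁ * b₁ + a₂ * b₀) * (a₂ + b₂) + (a₁ * b₂ + a₂ * b₁) * (a₁ + b₁) +
          a₂ * b₂ * (a₀ + b₀))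
        ((a₁ * b₂ + a₂ * b₁) * (a₂ + b₂) + a₂ * b₂ * (a₁ + b₁))
        (a₂ * b₂ * (a₂ + b₂)) := by
  simp only [quad, sextic, map_mul, map_add]; ring

/-! ### Non-proportional pairs and their algebraic independence in low degree -/

lemma distinct_iff {f g : Poly} :
    Distinct f g ↔ ∀ s t : ℂ, s • f + t • g = 0 → s = 0 ∧ t = 0 :=
  LinearIndependent.pair_iff

lemma Distinct.symm {f g : Poly} (h : Distinct f g) : Distinct g f := by
  rw [distinct_iff] at h ⊢
  intro s t hst
  exact (h t s (by rw [add_comm]; exact hst)).symm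

/-- An invertible linear recombination of a pair of non-proportional forms is again such a pair. -/
lemma Distinct.combine {f g : Poly} (h : Distinct f g) {a b c d : ℂ} (hd : a * d - b * c ≠ 0) :
    Distinct (a • f + b • g) (c • f + d • g) := by
  rw [distinct_iff] at h ⊢
  intro s t hst
  have := h (s * a + t * c) (s * b + t * d) (by rw [← hst]; module)
  constructor
  · apply (mul_eq_zero.1 (_ : s * (a * d - b * c) = 0)).resolve_right hd
    linear_combination d * this.1 - c * this.2
  · apply (mul_eq_zero.1 (_ : t * (a * d - b * c) = 0)).resolve_right hd
    linear_combination a * this.2 - b * this.1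

lemma span_combine (f g : Poly) {a b c d : ℂ} (hd : a * d - b * c ≠ 0) :
    Submodule.span ℂ {a • f + b • g, c • f + d • g} = Submodule.span ℂ {f, g} := by
  apply le_antisymm
  · rw [Submodule.span_le]
    rintro x (rfl | rfl)
    · exact Submodule.mem_span_pair.2 ⟨a, b, rfl⟩
    · exact Submodule.mem_span_pair.2 ⟨c, d, rfl⟩
  · rw [Submodule.span_le]
    obtain ⟨e, he⟩ : ∃ e, (a * d - b * c) * e = 1 := ⟨_, mul_inv_cancel₀ hd⟩
    rintro x (rfl | rfl)
    · refine Submodule.mem_span_pair.2 ⟨d * e, -b * e, ?_⟩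
      match_scalars
      · linear_combination he
      · ring
    · refine Submodule.mem_span_pair.2 ⟨-c * e, a * e, ?_⟩
      match_scalars
      · ring
      · linear_combination he

lemma Distinct.ne_zero_left {f g : Poly} (h : Distinct f g) : f ≠ 0 := LinearIndependent.ne_zero 0 h

lemma Distinct.ne_zero_right {f g : Poly} (h : Distinct f g) : g ≠ 0 := h.symm.ne_zero_left

lemma Distinct.sub_smul_ne_zero {f g : Poly} (h : Distinct f g) (r : ℂ) : f - r • g ≠ 0 := by
  intro h0
  have := distinct_iff.1 h 1 (-r) (by rw [← h0]; module)
  exact one_ne_zero this.1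

lemma exists_quadratic_root {a b c : ℂ} (ha : a ≠ 0) : ∃ r : ℂ, a * r ^ 2 + b * r + c = 0 := by
  obtain ⟨s, hs⟩ := IsAlgClosed.exists_pow_nat_eq (b ^ 2 - 4 * a * c) (n := 2) (by norm_num)
  refine ⟨(s - b) / (2 * a), ?_⟩
  field_simp
  linear_combination hs

lemma exists_cubic_root {a b c d : ℂ} (ha : a ≠ 0) :
    ∃ r : ℂ, a * r ^ 3 + b * r ^ 2 + c * r + d = 0 := by
  have hdeg := Polynomial.degree_cubic (b := b) (c := c) (d := d) ha
  obtain ⟨r, hr⟩ := IsAlgClosed.exists_root (Polynomial.C a * Polynomial.X ^ 3 +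
    Polynomial.C b * Polynomial.X ^ 2 + Polynomial.C c * Polynomial.X + Polynomial.C d)
    (by rw [hdeg]; norm_num)
  exact ⟨r, by simpa [Polynomial.IsRoot] using hr⟩

lemma Distinct.quadratic_relation {f g : Poly} (h : Distinct f g) {a b c : ℂ}
    (h0 : C a * f ^ 2 + C b * (f * g) + C c * g ^ 2 = 0) : a = 0 ∧ b = 0 ∧ c = 0 := by
  by_cases ha : a = 0
  · subst ha
    have h1 : g * (b • f + c • g) = 0 := by
      rw [← h0, smul_eq_C_mul, smul_eq_C_mul, map_zero]; ring
    obtain ⟨hb, hc⟩ := distinct_iff.1 h _ _ ((mul_eq_zero.1 h1).resolve_left h.ne_zero_right)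
    exact ⟨rfl, hb, hc⟩
  · exfalso
    obtain ⟨r, hr⟩ := exists_quadratic_root (b := b) (c := c) ha
    have hr' : (C a * C r ^ 2 + C b * C r + C c : Poly) = 0 := by
      rw [← map_zero C, ← hr]; simp
    have h1 : (f - r • g) * (a • f + (a * r + b) • g) = 0 := by
      simp only [smul_eq_C_mul, map_mul, map_add]
      linear_combination h0 - g ^ 2 * hr'
    exact ha (distinct_iff.1 h _ _ ((mul_eq_zero.1 h1).resolve_left (h.sub_smul_ne_zero r))).1

/-- A binary cubic over `ℂ` has a linear factor, and a nontrivial linear combination of independent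
forms is nonzero in a domain. Cancelling that factor reduces the relation to the quadratic one. -/
lemma Distinct.cubic_relation {f g : Poly} (h : Distinct f g) {a b c d : ℂ}
    (h0 : C a * f ^ 3 + C b * (f ^ 2 * g) + C c * (f * g ^ 2) + C d * g ^ 3 = 0) :
    a = 0 ∧ b = 0 ∧ c = 0 ∧ d = 0 := by
  by_cases ha : a = 0
  · subst ha
    have h1 : g * (C b * f ^ 2 + C c * (f * g) + C d * g ^ 2) = 0 := by
      rw [← h0, map_zero]; ring
    exact ⟨rfl, h.quadratic_relation ((mul_eq_zero.1 h1).resolve_left h.ne_zero_right)⟩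
  · exfalso
    obtain ⟨r, hr⟩ := exists_cubic_root (b := b) (c := c) (d := d) ha
    have hr' : (C a * C r ^ 3 + C b * C r ^ 2 + C c * C r + C d : Poly) = 0 := by
      rw [← map_zero C, ← hr]; simp
    have h1 : (f - r • g) * (C a * f ^ 2 + C (a * r + b) * (f * g) +
        C (a * r ^ 2 + b * r + c) * g ^ 2) = 0 := by
      simp only [smul_eq_C_mul, map_mul, map_add, map_pow]
      linear_combination h0 - g ^ 3 * hr'
    exact ha (h.quadratic_relation
      ((mul_eq_zero.1 h1).resolve_left (h.sub_smul_ne_zero r))).1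

lemma exists_cubeRoot : ∃ w : ℂ, w ^ 2 + w + 1 = 0 := by
  obtain ⟨w, hw⟩ := exists_quadratic_root (b := 1) (c := 1) one_ne_zero
  exact ⟨w, by linear_combination hw⟩

lemma exists_eq_smul_of_cube_eq {f g : Poly} (h : f ^ 3 = g ^ 3) :
    ∃ r : ℂ, r ≠ 0 ∧ f = r • g := by
  obtain ⟨w, hw⟩ := exists_cubeRoot
  have hw0 : w ≠ 0 := by rintro rfl; norm_num at hw
  have hw' : (C w ^ 2 + C w + 1 : Poly) = 0 := by
    rw [← map_zero C, ← hw]; simp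
  have h1 : (f - g) * ((f - w • g) * (f - (w ^ 2) • g)) = 0 := by
    simp only [smul_eq_C_mul, map_pow]
    linear_combination h + (-f ^ 2 * g + C w * f * g ^ 2 - (C w - 1) * g ^ 3) * hw'
  rcases mul_eq_zero.1 h1 with h1 | h1
  · exact ⟨1, one_ne_zero, by rw [one_smul]; exact sub_eq_zero.1 h1⟩
  · rcases mul_eq_zero.1 h1 with h1 | h1
    · exact ⟨w, hw0, sub_eq_zero.1 h1⟩
    · exact ⟨w ^ 2, pow_ne_zero 2 hw0, sub_eq_zero.1 h1⟩

/-! ### Representations as planes of quadratic forms -/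

lemma encard_image_eq_encard_image {α β γ : Type*} {T : Set α} {F : α → β} {G : α → γ}
    (h : ∀ x ∈ T, ∀ y ∈ T, F x = F y ↔ G x = G y) : (F '' T).encard = (G '' T).encard := by
  classical
  by_cases hT : T = ∅
  · simp [hT]
  obtain ⟨x₀, -⟩ := Set.nonempty_iff_ne_empty.2 hT
  have : Nonempty α := ⟨x₀⟩
  have hs : ∀ z ∈ F '' T, F.invFunOn T z ∈ T ∧ F (F.invFunOn T z) = z := fun z hz =>
    ⟨Function.invFunOn_mem hz, Function.invFunOn_eq hz⟩
  have himg : (fun z => G (F.invFunOn T z)) '' (F '' T) = G '' T := by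
    ext y
    constructor
    · rintro ⟨z, hz, rfl⟩
      exact ⟨_, (hs z hz).1, rfl⟩
    · rintro ⟨x, hx, rfl⟩
      have hz : F x ∈ F '' T := ⟨x, hx, rfl⟩
      exact ⟨F x, hz, (h _ (hs _ hz).1 _ hx).1 (hs _ hz).2⟩
  rw [← himg]
  refine (Set.InjOn.encard_image ?_).symm
  intro z hz z' hz' he
  rw [← (hs z hz).2, ← (hs z' hz').2]
  exact (h _ (hs z hz).1 _ (hs z' hz').1).2 he

/-- The pairs of quadratic forms whose cubes sum to `p`. -/
def cubePairs (p : Poly) : Set (Poly × Poly) :=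
  {x | x.1.IsHomogeneous 2 ∧ x.2.IsHomogeneous 2 ∧ Distinct x.1 x.2 ∧ p = x.1 ^ 3 + x.2 ^ 3}

/-- The planes of quadratic forms with a basis `a, b` such that `p = a * b * (a + b)`. -/
def planes (p : Poly) : Set (Submodule ℂ Poly) :=
  {V | ∃ a b : Poly, a.IsHomogeneous 2 ∧ b.IsHomogeneous 2 ∧ Distinct a b ∧
    p = a * b * (a + b) ∧ V = Submodule.span ℂ {a, b}}

lemma cubeReps_eq_image (p : Poly) :
    cubeReps p = (fun x : Poly × Poly => s(x.1 ^ 3, x.2 ^ 3)) '' cubePairs p := by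
  ext S
  constructor
  · rintro ⟨f, g, hf, hg, hd, hp, rfl⟩
    exact ⟨(f, g), ⟨hf, hg, hd, hp⟩, rfl⟩
  · rintro ⟨⟨f, g⟩, ⟨hf, hg, hd, hp⟩, rfl⟩
    exact ⟨f, g, hf, hg, hd, hp, rfl⟩

lemma isHomogeneous_combine {f g : Poly} (hf : f.IsHomogeneous 2) (hg : g.IsHomogeneous 2)
    (a b : ℂ) : (a • f + b • g).IsHomogeneous 2 := by
  rw [smul_eq_C_mul, smul_eq_C_mul]
  exact (hf.C_mul a).add (hg.C_mul b)

/-- With `ω` a primitive cube root of unity, the forms `-(f + g)`, `-(ωf + ω²g)` and their sum `ω²f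
+ ωg` have product `f³ + g³`. Here `w = √-3` stands in for `ω`; the coefficients in the other
direction come from inverting this substitution. -/
lemma planes_eq_image (p : Poly) :
    planes p = (fun x : Poly × Poly => Submodule.span ℂ {x.1, x.2}) '' cubePairs p := by
  obtain ⟨w, hw⟩ : ∃ w : ℂ, w ^ 2 = -3 := IsAlgClosed.exists_pow_nat_eq _ (by norm_num)
  have hw' : (C w ^ 2 : Poly) = -3 := by
    rw [← map_pow, hw, map_neg, map_ofNat]
  have hw0 : w ≠ 0 := by rintro rfl; norm_num at hw
  ext V
  constructor
  · rintro ⟨a, b, ha, hb, hd, rfl, rfl⟩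
    have hdet : (w / 6 - 1 / 2) * (-w / 3) - (w / 3) * (-w / 6 - 1 / 2) ≠ 0 := by
      have : (w / 6 - 1 / 2) * (-w / 3) - (w / 3) * (-w / 6 - 1 / 2) = w / 3 := by ring
      rw [this]
      exact div_ne_zero hw0 (by norm_num)
    refine ⟨((w / 6 - 1 / 2) • a + (w / 3) • b, (-w / 6 - 1 / 2) • a + (-w / 3) • b),
      ⟨isHomogeneous_combine ha hb _ _, isHomogeneous_combine ha hb _ _, hd.combine hdet, ?_⟩,
      span_combine a b hdet⟩
    have h2 : (C (1 / 2 : ℂ) : Poly) * 2 = 1 := by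
      rw [show (2 : Poly) = C 2 from (map_ofNat C 2).symm, ← map_mul]; norm_num
    have h3 : (C (1 / 3 : ℂ) : Poly) * 3 = 1 := by
      rw [show (3 : Poly) = C 3 from (map_ofNat C 3).symm, ← map_mul]; norm_num
    have e1 : (w / 6 - 1 / 2) • a + (w / 3) • b =
        -(C (1 / 2) * a) + C w * (C (1 / 3) * (C (1 / 2) * a + b)) := by
      simp only [← smul_eq_C_mul]; module
    have e2 : (-w / 6 - 1 / 2) • a + (-w / 3) • b =
        -(C (1 / 2) * a) - C w * (C (1 / 3) * (C (1 / 2) * a + b)) := by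
      simp only [← smul_eq_C_mul]; module
    -- Substituting `a = 2c` and `b = 3d - c` removes all denominators: the two quadratics become
    -- `-c ± w d`.
    obtain ⟨c, hc⟩ : ∃ c, c = C (1 / 2) * a := ⟨_, rfl⟩
    have hca : a = 2 * c := by rw [hc]; linear_combination -a * h2
    obtain ⟨d, hd⟩ : ∃ d, d = C (1 / 3) * (c + b) := ⟨_, rfl⟩
    have hdb : b = 3 * d - c := by rw [hd]; linear_combination -(c + b) * h3
    dsimp only
    rw [e1, e2, ← hc, ← hd, hdb, hca]
    linear_combination 6 * c * d ^ 2 * hw'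
  · rintro ⟨⟨f, g⟩, ⟨hf, hg, hd, rfl⟩, rfl⟩
    dsimp only at hf hg hd ⊢
    have hdet : (-1) * ((1 + w) / 2) - (-1) * ((1 - w) / 2) ≠ 0 := by
      have : (-1) * ((1 + w) / 2) - (-1) * ((1 - w) / 2) = -w := by ring
      rw [this]
      exact neg_ne_zero.2 hw0
    refine ⟨(-1 : ℂ) • f + (-1 : ℂ) • g, ((1 - w) / 2) • f + ((1 + w) / 2) • g,
      isHomogeneous_combine hf hg _ _, isHomogeneous_combine hf hg _ _, hd.combine hdet, ?_,
      (span_combine f g hdet).symm⟩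
    have e1 : (-1 : ℂ) • f + (-1 : ℂ) • g = -(f + g) := by module
    have e2 : ((1 - w) / 2) • f + ((1 + w) / 2) • g =
        C (1 / 2) * (f + g - C w * (f - g)) := by
      simp only [← smul_eq_C_mul]; module
    have e3 : -(f + g) + C (1 / 2) * (f + g - C w * (f - g)) =
        C (1 / 2) * (-(f + g) - C w * (f - g)) := by
      simp only [← smul_eq_C_mul]; module
    have h4 : (C (1 / 2 : ℂ) : Poly) ^ 2 * 4 = 1 := by
      rw [show (4 : Poly) = C 4 from (map_ofNat C 4).symm, ← map_pow, ← map_mul]; norm_num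
    rw [e1, e2, e3]
    linear_combination (-(f ^ 3 + g ^ 3)) * h4 + C (1 / 2) ^ 2 * (f + g) * (f - g) ^ 2 * hw'

lemma span_eq_of_smul {f g f' g' : Poly} {r s : ℂ} (hr : r ≠ 0) (hs : s ≠ 0)
    (hf : f = r • f') (hg : g = s • g') :
    Submodule.span ℂ {f, g} = Submodule.span ℂ {f', g'} := by
  have h := span_combine f' g' (a := r) (b := 0) (c := 0) (d := s) (by simp [hr, hs])
  rw [hf, hg, ← h]
  simp

/-- The linear substitutions preserving `X³ + Y³` are the monomial ones with cube roots of unity as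
entries, so two bases of one plane with the same sum of cubes have the same cubes. -/
lemma cubes_eq_iff_span_eq {p : Poly} {x y : Poly × Poly} (hx : x ∈ cubePairs p)
    (hy : y ∈ cubePairs p) : s(x.1 ^ 3, x.2 ^ 3) = s(y.1 ^ 3, y.2 ^ 3) ↔
      Submodule.span ℂ {x.1, x.2} = Submodule.span ℂ {y.1, y.2} := by
  obtain ⟨f, g⟩ := x
  obtain ⟨f', g'⟩ := y
  obtain ⟨-, -, hd, hp⟩ := hx
  obtain ⟨-, -, hd', hp'⟩ := hy
  dsimp only at hd hd' hp hp' ⊢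
  constructor
  · intro h
    rcases Sym2.eq_iff.1 h with ⟨h1, h2⟩ | ⟨h1, h2⟩
    · obtain ⟨r, hr, hf⟩ := exists_eq_smul_of_cube_eq h1
      obtain ⟨s, hs, hg⟩ := exists_eq_smul_of_cube_eq h2
      exact span_eq_of_smul hr hs hf hg
    · obtain ⟨r, hr, hf⟩ := exists_eq_smul_of_cube_eq h1
      obtain ⟨s, hs, hg⟩ := exists_eq_smul_of_cube_eq h2
      rw [span_eq_of_smul hr hs hf hg, Set.pair_comm]
  · intro h
    have hf : f ∈ Submodule.span ℂ {f', g'} := h ▸ Submodule.subset_span (by simp)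
    have hg : g ∈ Submodule.span ℂ {f', g'} := h ▸ Submodule.subset_span (by simp)
    obtain ⟨a, b, rfl⟩ := Submodule.mem_span_pair.1 hf
    obtain ⟨c, d, rfl⟩ := Submodule.mem_span_pair.1 hg
    obtain ⟨h0, h1, h2, h3⟩ := hd'.cubic_relation (a := a ^ 3 + c ^ 3 - 1)
      (b := 3 * (a ^ 2 * b + c ^ 2 * d)) (c := 3 * (a * b ^ 2 + c * d ^ 2))
      (d := b ^ 3 + d ^ 3 - 1) (by
        have := hp.symm.trans hp'
        simp only [smul_eq_C_mul] at this
        simp only [map_sub, map_add, map_mul, map_pow, map_one, map_ofNat]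
        linear_combination this)
    have hdet : a * d - b * c ≠ 0 := by
      intro h0'
      have h4 := distinct_iff.1 hd d (-b) (by
        match_scalars
        · linear_combination h0'
        · ring)
      have h5 := distinct_iff.1 hd c (-a) (by
        match_scalars
        · ring
        · linear_combination -h0')
      rw [neg_eq_zero.1 h5.2, h5.1] at h0
      norm_num at h0
    -- The mixed coefficients give a linear system for `ab` and `cd` with matrix `(a c; b d)`, which
    -- is invertible.
    have hab : a * b = 0 := by
      have : a * b * (a * d - b * c) = 0 := by linear_combination d / 3 * h1 - c / 3 * h2
      exact (mul_eq_zero.1 this).resolve_right hdet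
    have hcd : c * d = 0 := by
      have : c * d * (a * d - b * c) = 0 := by linear_combination a / 3 * h2 - b / 3 * h1
      exact (mul_eq_zero.1 this).resolve_right hdet
    rcases mul_eq_zero.1 hab with rfl | rfl
    · have hc : c ≠ 0 := by rintro rfl; simp at hdet
      obtain rfl : d = 0 := (mul_eq_zero.1 hcd).resolve_left hc
      have hb3 : b ^ 3 = 1 := by linear_combination h3
      have hc3 : c ^ 3 = 1 := by linear_combination h0
      simp [smul_pow, hb3, hc3, Sym2.eq_swap]
    · have hd : d ≠ 0 := by rintro rfl; simp at hdet
      obtain rfl : c = 0 := (mul_eq_zero.1 hcd).resolve_right hd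
      have ha3 : a ^ 3 = 1 := by linear_combination h0
      have hd3 : d ^ 3 = 1 := by linear_combination h3
      simp [smul_pow, ha3, hd3]

lemma N_eq_encard_planes (p : Poly) : N p = (planes p).encard := by
  rw [N, cubeReps_eq_image, planes_eq_image]
  exact encard_image_eq_encard_image fun x hx y hy => cubes_eq_iff_span_eq hx hy

/-! ### Linear changes of variables and invariance of `N` -/

/-- The linear change of variables `f ↦ f ∘ M` as an algebra homomorphism. -/
noncomputable def compHom (M : Matrix.GeneralLinearGroup (Fin 2) ℂ) : Poly →ₐ[ℂ] Poly :=
  aeval (fun i : Fin 2 => C ((M : Matrix (Fin 2) (Fin 2) ℂ) i 0) * X 0 +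
    C ((M : Matrix (Fin 2) (Fin 2) ℂ) i 1) * X 1)

lemma comp_eq_compHom (f : Poly) (M : Matrix.GeneralLinearGroup (Fin 2) ℂ) :
    comp f M = compHom M f := rfl

lemma compHom_C (M : Matrix.GeneralLinearGroup (Fin 2) ℂ) (c : ℂ) : compHom M (C c) = C c :=
  (compHom M).commutes c

lemma compHom_X (M : Matrix.GeneralLinearGroup (Fin 2) ℂ) (i : Fin 2) :
    compHom M (X i) = C ((M : Matrix (Fin 2) (Fin 2) ℂ) i 0) * X 0 +
      C ((M : Matrix (Fin 2) (Fin 2) ℂ) i 1) * X 1 := by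
  simp [compHom]

/-- Substitution is a right action, hence the order of the product. -/
lemma compHom_compHom (M M' : Matrix.GeneralLinearGroup (Fin 2) ℂ) (f : Poly) :
    compHom M' (compHom M f) = compHom (M * M') f := by
  have : (compHom M').comp (compHom M) = compHom (M * M') := by
    ext i : 1
    simp only [AlgHom.comp_apply, compHom_X, map_add, map_mul, compHom_C, Units.val_mul,
      Matrix.mul_apply, Fin.sum_univ_two]
    ring
  rw [← this]; rfl

lemma compHom_one (f : Poly) : compHom 1 f = f := by
  have : compHom 1 = AlgHom.id ℂ Poly := by
    ext i : 1
    fin_cases i <;> simp [compHom_X]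
  rw [this]; rfl

lemma compHom_inv_compHom (M : Matrix.GeneralLinearGroup (Fin 2) ℂ) (f : Poly) :
    compHom M⁻¹ (compHom M f) = f := by
  rw [compHom_compHom, mul_inv_cancel, compHom_one]

lemma compHom_injective (M : Matrix.GeneralLinearGroup (Fin 2) ℂ) :
    Function.Injective (compHom M) :=
  Function.LeftInverse.injective (compHom_inv_compHom M)

lemma compHom_quad (M : Matrix.GeneralLinearGroup (Fin 2) ℂ) {p q r s : ℂ}
    (hM : (M : Matrix (Fin 2) (Fin 2) ℂ) = !![p, q; r, s]) (a b c : ℂ) :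
    compHom M (quad a b c) = quad (a * p ^ 2 + b * p * r + c * r ^ 2)
      (2 * a * p * q + b * (p * s + q * r) + 2 * c * r * s)
      (a * q ^ 2 + b * q * s + c * s ^ 2) := by
  simp only [quad, map_add, map_mul, map_pow, compHom_X, compHom_C, hM, map_ofNat,
    Matrix.of_apply, Matrix.cons_val_zero, Matrix.cons_val_one, Matrix.cons_val',
    Matrix.cons_val_fin_one]
  ring

lemma isHomogeneous_compHom {f : Poly} (hf : f.IsHomogeneous 2)
    (M : Matrix.GeneralLinearGroup (Fin 2) ℂ) : (compHom M f).IsHomogeneous 2 := by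
  obtain ⟨a, b, c, rfl⟩ := exists_eq_quad hf
  rw [compHom_quad M (Matrix.eta_fin_two _)]
  exact isHomogeneous_quad _ _ _

lemma map_span_pair (M : Matrix.GeneralLinearGroup (Fin 2) ℂ) (f g : Poly) :
    (Submodule.span ℂ {f, g}).map (compHom M).toLinearMap =
      Submodule.span ℂ {compHom M f, compHom M g} := by
  rw [Submodule.map_span, Set.image_pair]; rfl

lemma map_mem_planes {p : Poly} {V : Submodule ℂ Poly} (hV : V ∈ planes p)
    (M : Matrix.GeneralLinearGroup (Fin 2) ℂ) :
    V.map (compHom M).toLinearMap ∈ planes (comp p M) := by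
  obtain ⟨a, b, ha, hb, hd, rfl, rfl⟩ := hV
  refine ⟨compHom M a, compHom M b, isHomogeneous_compHom ha M, isHomogeneous_compHom hb M, ?_, ?_,
    map_span_pair M a b⟩
  · rw [distinct_iff] at hd ⊢
    intro s t hst
    apply hd
    apply compHom_injective M
    rw [map_add, map_smul, map_smul, hst, map_zero]
  · simp only [comp_eq_compHom, map_mul, map_add]

lemma N_le_N_comp (p : Poly) (M : Matrix.GeneralLinearGroup (Fin 2) ℂ) : N p ≤ N (comp p M) := by
  rw [N_eq_encard_planes, N_eq_encard_planes]
  have hinj := Submodule.map_injective_of_injective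
    (f := (compHom M).toLinearMap) (compHom_injective M)
  rw [← hinj.encard_image]
  apply Set.encard_le_encard
  rintro _ ⟨V, hV, rfl⟩
  exact map_mem_planes hV M

lemma N_comp (p : Poly) (M : Matrix.GeneralLinearGroup (Fin 2) ℂ) : N (comp p M) = N p := by
  refine le_antisymm ?_ (N_le_N_comp p M)
  have h := N_le_N_comp (comp p M) M⁻¹
  rwa [comp_eq_compHom (comp p M), comp_eq_compHom p, compHom_inv_compHom] at h

lemma Similar.N_eq {p q : Poly} (h : Similar p q) : N p = N q := by
  obtain ⟨M, rfl⟩ := h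
  exact N_comp q M

lemma Similar.symm {p q : Poly} (h : Similar p q) : Similar q p := by
  obtain ⟨M, rfl⟩ := h
  exact ⟨M⁻¹, (compHom_inv_compHom M q).symm⟩

lemma Similar.trans {p q r : Poly} (h : Similar p q) (h' : Similar q r) : Similar p r := by
  obtain ⟨M, rfl⟩ := h
  obtain ⟨M', rfl⟩ := h'
  exact ⟨M' * M, compHom_compHom M' M r⟩

/-- The invertible matrix with the given entries. -/
noncomputable def gl (p q r s : ℂ) (h : p * s - q * r ≠ 0) :
    Matrix.GeneralLinearGroup (Fin 2) ℂ :=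
  Matrix.GeneralLinearGroup.mkOfDetNeZero !![p, q; r, s] (by rwa [Matrix.det_fin_two_of])

lemma coe_gl (p q r s : ℂ) (h : p * s - q * r ≠ 0) :
    (gl p q r s h : Matrix (Fin 2) (Fin 2) ℂ) = !![p, q; r, s] := rfl

/-! ### Normal forms of planes -/

/-- In the span of two binary quadratic forms there is a nonzero square. -/
lemma exists_square_mem (a₀ a₁ a₂ b₀ b₁ b₂ : ℂ) : ∃ s t : ℂ, (s ≠ 0 ∨ t ≠ 0) ∧
    (s * a₁ + t * b₁) ^ 2 = 4 * (s * a₀ + t * b₀) * (s * a₂ + t * b₂) := by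
  -- The discriminant is a quadratic form on the pencil, so it has a nontrivial zero; the case split
  -- asks whether `(1, 0)` is one.
  by_cases h : a₁ ^ 2 - 4 * a₀ * a₂ = 0
  · exact ⟨1, 0, Or.inl one_ne_zero, by linear_combination h⟩
  · obtain ⟨s, hs⟩ := exists_quadratic_root (b := 2 * a₁ * b₁ - 4 * (a₀ * b₂ + a₂ * b₀))
      (c := b₁ ^ 2 - 4 * b₀ * b₂) h
    exact ⟨s, 1, Or.inr one_ne_zero, by linear_combination hs⟩

lemma exists_compHom_eq_sq {a b c : ℂ} (h : b ^ 2 = 4 * a * c) (h0 : quad a b c ≠ 0) :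
    ∃ (M : Matrix.GeneralLinearGroup (Fin 2) ℂ) (d : ℂ), d ≠ 0 ∧
      compHom M (quad a b c) = d • quad 1 0 0 := by
  by_cases ha : a = 0
  · subst ha
    obtain rfl : b = 0 := by simpa using h
    have hc : c ≠ 0 := by rintro rfl; exact h0 quad_zero
    refine ⟨gl 0 1 1 0 (by norm_num), c, hc, ?_⟩
    rw [compHom_quad _ (coe_gl _ _ _ _ _), smul_quad]
    congr 1 <;> ring
  · refine ⟨gl 1 (-b / (2 * a)) 0 1 (by norm_num), a, ha, ?_⟩
    rw [compHom_quad _ (coe_gl _ _ _ _ _), smul_quad]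
    congr 1
    · ring
    · field_simp; ring
    · field_simp; linear_combination -h

/-- Every plane of binary quadratic forms is equivalent to `⟨x², xy⟩` or to `⟨x², y²⟩`. -/
lemma exists_map_eq_normalForm {a b : Poly} (ha : a.IsHomogeneous 2) (hb : b.IsHomogeneous 2)
    (hd : Distinct a b) : ∃ M : Matrix.GeneralLinearGroup (Fin 2) ℂ,
      (Submodule.span ℂ {a, b}).map (compHom M).toLinearMap =
          Submodule.span ℂ {quad 1 0 0, quad 0 1 0} ∨
      (Submodule.span ℂ {a, b}).map (compHom M).toLinearMap =
          Submodule.span ℂ {quad 1 0 0, quad 0 0 1} := by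
  obtain ⟨u, v, hu, hv, huv, hspan, husq⟩ : ∃ u v : Poly, u.IsHomogeneous 2 ∧ v.IsHomogeneous 2 ∧
      Distinct u v ∧ Submodule.span ℂ {u, v} = Submodule.span ℂ {a, b} ∧
      ∃ u₀ u₁ u₂ : ℂ, u = quad u₀ u₁ u₂ ∧ u₁ ^ 2 = 4 * u₀ * u₂ := by
    obtain ⟨a₀, a₁, a₂, rfl⟩ := exists_eq_quad ha
    obtain ⟨b₀, b₁, b₂, rfl⟩ := exists_eq_quad hb
    obtain ⟨s, t, hst, h⟩ := exists_square_mem a₀ a₁ a₂ b₀ b₁ b₂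
    have hsq : ∃ u₀ u₁ u₂ : ℂ, s • quad a₀ a₁ a₂ + t • quad b₀ b₁ b₂ = quad u₀ u₁ u₂ ∧
        u₁ ^ 2 = 4 * u₀ * u₂ := ⟨_, _, _, by rw [smul_quad, smul_quad, quad_add], h⟩
    rcases hst with hs | ht
    · have hdet : s * 1 - t * 0 ≠ 0 := by simpa
      exact ⟨_, _, isHomogeneous_combine ha hb s t, isHomogeneous_combine ha hb 0 1,
        hd.combine hdet, span_combine _ _ hdet, hsq⟩
    · have hdet : s * 0 - t * 1 ≠ 0 := by simpa
      exact ⟨_, _, isHomogeneous_combine ha hb s t, isHomogeneous_combine ha hb 1 0,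
        hd.combine hdet, span_combine _ _ hdet, hsq⟩
  obtain ⟨u₀, u₁, u₂, rfl, h⟩ := husq
  obtain ⟨M, d, hd0, hM⟩ := exists_compHom_eq_sq h huv.ne_zero_left
  obtain ⟨v₀, v₁, v₂, hv'⟩ := exists_eq_quad (isHomogeneous_compHom hv M)
  rw [← hspan]
  by_cases h2 : v₂ = 0
  · have h1 : v₁ ≠ 0 := by
      rintro rfl
      have := distinct_iff.1 huv v₀ (-d) (by
        apply compHom_injective M
        rw [map_add, map_smul, map_smul, hM, hv', h2, map_zero, smul_quad, smul_quad, smul_quad,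
          quad_add, ← quad_zero]
        congr 1 <;> ring)
      exact hd0 (neg_eq_zero.1 this.2)
    refine ⟨M, Or.inl ?_⟩
    rw [map_span_pair, hM, hv', h2, ← span_combine (quad 1 0 0) (quad 0 1 0) (a := d) (b := 0)
      (c := v₀) (d := v₁) (by simp [hd0, h1])]
    simp only [smul_quad, quad_add]
    simp
  -- Completing the square in `y` removes the `xy` term of the second form and leaves `x²` alone.
  · refine ⟨M * gl 1 0 (-v₁ / (2 * v₂)) 1 (by norm_num), Or.inr ?_⟩
    have e1 : compHom (gl 1 0 (-v₁ / (2 * v₂)) 1 (by norm_num)) (quad (d * 1) (d * 0) (d * 0)) =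
        d • quad 1 0 0 + (0 : ℂ) • quad 0 0 1 := by
      rw [compHom_quad _ (coe_gl _ _ _ _ _), smul_quad, smul_quad, quad_add]
      congr 1 <;> ring
    have e2 : compHom (gl 1 0 (-v₁ / (2 * v₂)) 1 (by norm_num)) (quad v₀ v₁ v₂) =
        (v₀ - v₁ ^ 2 / (4 * v₂)) • quad 1 0 0 + v₂ • quad 0 0 1 := by
      rw [compHom_quad _ (coe_gl _ _ _ _ _), smul_quad, smul_quad, quad_add]
      congr 1 <;> (field_simp; ring)
    rw [map_span_pair, ← compHom_compHom, ← compHom_compHom, hM, hv', smul_quad, e1, e2,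
      span_combine _ _ (by simp [hd0, h2])]

/-- If `p` vanishes at `(0, 1)`, then the factors in `p = a * b * (a + b)` can be permuted so
that `a` vanishes there. -/
lemma exists_basis_of_mem_planes {c₀ c₁ c₂ c₃ c₄ c₅ : ℂ} {V : Submodule ℂ Poly}
    (hV : V ∈ planes (sextic c₀ c₁ c₂ c₃ c₄ c₅ 0)) : ∃ a₀ a₁ b₀ b₁ b₂ : ℂ,
      Distinct (quad a₀ a₁ 0) (quad b₀ b₁ b₂) ∧
      sextic c₀ c₁ c₂ c₃ c₄ c₅ 0 =
        quad a₀ a₁ 0 * quad b₀ b₁ b₂ * (quad a₀ a₁ 0 + quad b₀ b₁ b₂) ∧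
      V = Submodule.span ℂ {quad a₀ a₁ 0, quad b₀ b₁ b₂} := by
  obtain ⟨a, b, ha, hb, hd, hp, rfl⟩ := hV
  obtain ⟨a₀, a₁, a₂, rfl⟩ := exists_eq_quad ha
  obtain ⟨b₀, b₁, b₂, rfl⟩ := exists_eq_quad hb
  have h := hp
  rw [quad_mul_mul_add, sextic_inj] at h
  rcases mul_eq_zero.1 h.2.2.2.2.2.2.symm with h | h
  · rcases mul_eq_zero.1 h with rfl | rfl
    · exact ⟨a₀, a₁, b₀, b₁, b₂, hd, hp, rfl⟩
    · exact ⟨b₀, b₁, a₀, a₁, a₂, hd.symm, by rw [hp]; ring, by rw [Set.pair_comm]⟩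
  · have hdet : (-1 : ℂ) * 1 - (-1) * 0 ≠ 0 := by norm_num
    have e1 : (-1 : ℂ) • quad a₀ a₁ a₂ + (-1 : ℂ) • quad b₀ b₁ b₂ =
        quad (-(a₀ + b₀)) (-(a₁ + b₁)) 0 := by
      rw [smul_quad, smul_quad, quad_add]
      congr 1
      · ring
      · ring
      · linear_combination -h
    have e2 : (0 : ℂ) • quad a₀ a₁ a₂ + (1 : ℂ) • quad b₀ b₁ b₂ = quad b₀ b₁ b₂ := by simp
    have hd' := hd.combine hdet
    have hs' := span_combine (quad a₀ a₁ a₂) (quad b₀ b₁ b₂) hdet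
    rw [e2] at hd' hs'
    rw [e1] at hd' hs'
    refine ⟨_, _, b₀, b₁, b₂, hd', ?_, hs'.symm⟩
    rw [← e1, hp]
    simp only [neg_smul, one_smul]
    ring

/-- Here `x³` divides `p`. In any factorization, with `x` dividing the first factor, either `x`
divides all three factors and the plane is `⟨x², xy⟩`, or it divides neither of the others, and then
`x³` would divide a nonzero quadratic. -/
lemma planes_eq_singleton_of_degenerate {p : Poly}
    (h : Submodule.span ℂ {quad 1 0 0, quad 0 1 0} ∈ planes p) :
    planes p = {Submodule.span ℂ {quad 1 0 0, quad 0 1 0}} := by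
  refine Set.Subset.antisymm ?_ (Set.singleton_subset_iff.2 h)
  obtain ⟨a, b, -, -, -, rfl, hs⟩ := h
  have hmem : ∀ f ∈ Submodule.span ℂ {quad 1 0 0, quad 0 1 0}, ∃ f₀ f₁ : ℂ, f = quad f₀ f₁ 0 := by
    intro f hf
    obtain ⟨f₀, f₁, rfl⟩ := Submodule.mem_span_pair.1 hf
    refine ⟨f₀, f₁, ?_⟩
    rw [smul_quad, smul_quad, quad_add]
    congr 1 <;> ring
  obtain ⟨a₀, a₁, rfl⟩ := hmem a (by rw [hs]; exact Submodule.subset_span (by simp))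
  obtain ⟨b₀, b₁, rfl⟩ := hmem b (by rw [hs]; exact Submodule.subset_span (by simp))
  intro V hV
  rw [quad_mul_mul_add] at hV
  simp only [mul_zero, zero_mul, add_zero, zero_add] at hV
  obtain ⟨c₀, c₁, d₀, d₁, d₂, hd, hp, rfl⟩ := exists_basis_of_mem_planes hV
  rw [quad_mul_mul_add, sextic_inj] at hp
  obtain ⟨-, -, -, -, h4, h5, -⟩ := hp
  have hd2 : d₂ = 0 := by
    by_contra hd2
    have hc1 : c₁ = 0 := by
      have : c₁ * d₂ ^ 2 = 0 := by linear_combination -h5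
      exact (mul_eq_zero.1 this).resolve_right (pow_ne_zero 2 hd2)
    subst hc1
    have hc0 : c₀ = 0 := by
      have : c₀ * d₂ ^ 2 = 0 := by linear_combination -h4
      exact (mul_eq_zero.1 this).resolve_right (pow_ne_zero 2 hd2)
    subst hc0
    exact hd.ne_zero_left quad_zero
  subst hd2
  have hdet : c₀ * d₁ - c₁ * d₀ ≠ 0 := by
    intro h0
    have h1 := distinct_iff.1 hd d₁ (-c₁) (by
      rw [smul_quad, smul_quad, quad_add, ← quad_zero]
      congr 1
      · linear_combination h0
      · ring
      · ring)
    have h2 := distinct_iff.1 hd d₀ (-c₀) (by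
      rw [smul_quad, smul_quad, quad_add, ← quad_zero]
      congr 1
      · ring
      · linear_combination -h0
      · ring)
    apply hd.ne_zero_left
    rw [neg_eq_zero.1 h1.2, neg_eq_zero.1 h2.2, quad_zero]
  rw [Set.mem_singleton_iff, ← span_combine (quad 1 0 0) (quad 0 1 0) hdet]
  simp only [smul_quad, quad_add]
  simp

/-! ### Counting planes for `xy(x⁴ + k x²y² + y⁴)` -/

/-- The plane spanned by `x² + r x y` and `s x y + y²`. -/
noncomputable def crossPlane (r s : ℂ) : Submodule ℂ Poly :=
  Submodule.span ℂ {quad 1 r 0, quad 0 s 1}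

/-- The plane spanned by `x y` and `x² + e y²`. -/
noncomputable def axisPlane (e : ℂ) : Submodule ℂ Poly :=
  Submodule.span ℂ {quad 0 1 0, quad 1 0 e}

lemma quad_mem_crossPlane {r s a b c : ℂ} :
    quad a b c ∈ crossPlane r s ↔ b = a * r + c * s := by
  rw [crossPlane, Submodule.mem_span_pair]
  simp only [smul_quad, quad_add, quad_inj]
  constructor
  · rintro ⟨u, v, h0, h1, h2⟩
    rw [← h1, ← h0, ← h2]; ring
  · intro h
    exact ⟨a, c, by ring, by rw [h], by ring⟩

lemma quad_mem_axisPlane {e a b c : ℂ} : quad a b c ∈ axisPlane e ↔ c = a * e := by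
  rw [axisPlane, Submodule.mem_span_pair]
  simp only [smul_quad, quad_add, quad_inj]
  constructor
  · rintro ⟨u, v, h0, h1, h2⟩
    rw [← h2, ← h0]; ring
  · intro h
    exact ⟨b, a, by ring, by ring, by rw [h]; ring⟩

lemma crossPlane_injective_left {r s r' s' : ℂ} (h : crossPlane r s = crossPlane r' s') :
    r = r' := by
  have h1 : quad 1 r 0 ∈ crossPlane r s := quad_mem_crossPlane.2 (by ring)
  rw [h, quad_mem_crossPlane] at h1
  linear_combination h1

lemma axisPlane_injective : Function.Injective axisPlane := by
  intro e e' h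
  have h1 : quad 1 0 e ∈ axisPlane e := quad_mem_axisPlane.2 (by ring)
  rw [h, quad_mem_axisPlane] at h1
  linear_combination h1

lemma crossPlane_ne_axisPlane {r s e : ℂ} : crossPlane r s ≠ axisPlane e := by
  intro h
  have h1 : quad 0 1 0 ∈ axisPlane e := quad_mem_axisPlane.2 (by ring)
  rw [← h, quad_mem_crossPlane] at h1
  norm_num at h1

lemma span_quad_eq_crossPlane {a₀ a₁ b₁ b₂ : ℂ} (ha : a₀ ≠ 0) (hb : b₂ ≠ 0) :
    Submodule.span ℂ {quad a₀ a₁ 0, quad 0 b₁ b₂} = crossPlane (a₁ / a₀) (b₁ / b₂) := by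
  rw [crossPlane, ← span_combine (quad 1 (a₁ / a₀) 0) (quad 0 (b₁ / b₂) 1) (a := a₀) (b := 0)
    (c := 0) (d := b₂) (by simp [ha, hb])]
  simp only [smul_quad, quad_add, mul_div_cancel₀ _ ha, mul_div_cancel₀ _ hb]
  simp

lemma span_quad_eq_axisPlane {m b₀ b₁ b₂ e : ℂ} (hm : m ≠ 0) (hb : b₀ ≠ 0) (he : b₂ = b₀ * e) :
    Submodule.span ℂ {quad 0 m 0, quad b₀ b₁ b₂} = axisPlane e := by
  rw [axisPlane, ← span_combine (quad 0 1 0) (quad 1 0 e) (a := m) (b := 0)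
    (c := b₁) (d := b₀) (by simp [hm, hb])]
  simp only [smul_quad, quad_add, he]
  simp

lemma distinct_quad {a₀ a₁ a₂ b₀ b₁ b₂ : ℂ}
    (h : a₀ * b₁ - a₁ * b₀ ≠ 0 ∨ a₀ * b₂ - a₂ * b₀ ≠ 0 ∨ a₁ * b₂ - a₂ * b₁ ≠ 0) :
    Distinct (quad a₀ a₁ a₂) (quad b₀ b₁ b₂) := by
  rw [distinct_iff]
  intro s t hst
  rw [smul_quad, smul_quad, quad_add, ← quad_zero, quad_inj] at hst
  obtain ⟨h0, h1, h2⟩ := hst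
  rcases h with h | h | h
  · constructor
    · apply (mul_eq_zero.1 (_ : s * _ = 0)).resolve_right h
      linear_combination b₁ * h0 - b₀ * h1
    · apply (mul_eq_zero.1 (_ : t * _ = 0)).resolve_right h
      linear_combination a₀ * h1 - a₁ * h0
  · constructor
    · apply (mul_eq_zero.1 (_ : s * _ = 0)).resolve_right h
      linear_combination b₂ * h0 - b₀ * h2
    · apply (mul_eq_zero.1 (_ : t * _ = 0)).resolve_right h
      linear_combination a₀ * h2 - a₂ * h0
  · constructor
    · apply (mul_eq_zero.1 (_ : s * _ = 0)).resolve_right h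
      linear_combination b₂ * h1 - b₁ * h2
    · apply (mul_eq_zero.1 (_ : t * _ = 0)).resolve_right h
      linear_combination a₁ * h2 - a₂ * h1

/-- The sextic `x y (x⁴ + k x² y² + y⁴)`. -/
noncomputable def axisSextic (k : ℂ) : Poly := sextic 0 1 0 k 0 1 0

/-- With `xy` kept in one factor, `x⁴ + k x²y² + y⁴ = (x² + e y²)² - (2e - k)x²y²` is a difference
of squares. At `k = 2e` its two factors coincide and no plane arises. -/
lemma axisPlane_mem_planes {k e : ℂ} (he : e ^ 2 = 1) (hk : k ≠ 2 * e) :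
    axisPlane e ∈ planes (axisSextic k) := by
  obtain ⟨m, hm⟩ := IsAlgClosed.exists_pow_nat_eq (4 * (2 * e - k)) (n := 3) (by norm_num)
  have hm0 : m ≠ 0 := by
    rintro rfl
    apply hk
    linear_combination hm / 4
  obtain ⟨b, hb⟩ := IsAlgClosed.exists_pow_nat_eq (1 / m) (n := 2) (by norm_num)
  have hb' : m * b ^ 2 = 1 := by rw [hb]; field_simp
  have hb0 : b ≠ 0 := by rintro rfl; norm_num at hb'
  refine ⟨quad 0 m 0, quad b (-m / 2) (b * e), isHomogeneous_quad _ _ _, isHomogeneous_quad _ _ _,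
    distinct_quad (Or.inl (by simp [hm0, hb0])), ?_, (span_quad_eq_axisPlane hm0 hb0 rfl).symm⟩
  rw [quad_mul_mul_add, axisSextic, sextic_inj]
  refine ⟨by ring, by linear_combination -hb', by ring, ?_, by ring, ?_, by ring⟩
  · linear_combination hm / 4 - 2 * e * hb'
  · linear_combination -e ^ 2 * hb' - he

/-- The roots of `xy(x⁴ + y⁴)` are the vertices of an octahedron. The factors are proportional to
`x(x + ry)`, `y(x - ry)` and `x² + r²y²`; the condition on `u³` normalizes their product. -/
lemma crossPlane_mem_planes_of_octahedral {r : ℂ} (hr : r ^ 4 = -1) :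
    crossPlane r (-1 / r) ∈ planes (axisSextic 0) := by
  have hr0 : r ≠ 0 := by rintro rfl; norm_num at hr
  obtain ⟨u, hu⟩ := IsAlgClosed.exists_pow_nat_eq (-r ^ 2) (n := 3) (by norm_num)
  have hu0 : u ≠ 0 := by
    rintro rfl
    apply hr0
    simpa using hu
  refine ⟨quad (u / r) u 0, quad 0 (-u) (u * r), isHomogeneous_quad _ _ _,
    isHomogeneous_quad _ _ _, distinct_quad (Or.inl ?_), ?_, ?_⟩
  · simp [hu0, hr0]
  · rw [quad_mul_mul_add, axisSextic, sextic_inj]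
    have h1 : (u / r) ^ 2 * u = -1 := by
      field_simp
      linear_combination hu
    have h2 : (u / r) * r = u := by field_simp
    generalize u / r = v at h1 h2
    subst h2
    refine ⟨by ring, by linear_combination h1, by ring, by ring, by ring, ?_, by ring⟩
    linear_combination hr - r ^ 4 * h1
  · rw [span_quad_eq_crossPlane (div_ne_zero hu0 hr0) (mul_ne_zero hu0 hr0)]
    congr 1 <;> field_simp

/-- The roots `0, ∞, ±r, ±3r` form a regular hexagon up to projectivity. The factors are
proportional to `x(x + ry)`, `y(x - 3ry)` and `(x - ry)(x + 3ry)`. -/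
lemma crossPlane_mem_planes_of_hexagonal {k r : ℂ} (hk : 9 * k ^ 2 = 100) (hr : 10 * r ^ 2 = -k) :
    crossPlane r (-1 / (3 * r)) ∈ planes (axisSextic k) := by
  have hr4 : 9 * r ^ 4 = 1 := by
    have : k = -(10 * r ^ 2) := by linear_combination hr
    rw [this] at hk
    linear_combination hk / 100
  have hr0 : r ≠ 0 := by rintro rfl; norm_num at hr4
  obtain ⟨u, hu⟩ := IsAlgClosed.exists_pow_nat_eq (r ^ 2) (n := 3) (by norm_num)
  have hu0 : u ≠ 0 := by
    rintro rfl
    apply hr0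
    simpa using hu.symm
  refine ⟨quad (u / r) u 0, quad 0 u (-3 * u * r), isHomogeneous_quad _ _ _,
    isHomogeneous_quad _ _ _, distinct_quad (Or.inl ?_), ?_, ?_⟩
  · simp [hu0, hr0]
  · rw [quad_mul_mul_add, axisSextic, sextic_inj]
    have h1 : (u / r) ^ 2 * u = 1 := by
      field_simp
      linear_combination hu
    have h2 : (u / r) * r = u := by field_simp
    have h3 : k = -10 * u ^ 3 := by linear_combination hr + 10 * hu
    generalize u / r = v at h1 h2
    subst h2
    refine ⟨by ring, by linear_combination -h1, by ring, by rw [h3]; ring, by ring, ?_, by ring⟩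
    linear_combination -9 * r ^ 4 * h1 - hr4
  · rw [span_quad_eq_crossPlane (div_ne_zero hu0 hr0) (by simp [hu0, hr0])]
    congr 1 <;> field_simp

/-- The simple factors `x` and `y` lie either in the same quadratic, giving an axis plane, or in two
different ones, giving a cross plane. -/
lemma planes_axisSextic_cases {k : ℂ} {V : Submodule ℂ Poly} (hV : V ∈ planes (axisSextic k)) :
    (∃ e, e ^ 2 = 1 ∧ k ≠ 2 * e ∧ V = axisPlane e) ∨
    (k = 0 ∧ ∃ r, r ^ 4 = -1 ∧ V = crossPlane r (-1 / r)) ∨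
    (9 * k ^ 2 = 100 ∧ ∃ r, 10 * r ^ 2 = -k ∧ V = crossPlane r (-1 / (3 * r))) := by
  obtain ⟨a₀, a₁, b₀, b₁, b₂, hd, hp, rfl⟩ := exists_basis_of_mem_planes hV
  by_cases ha₀ : a₀ = 0
  · left
    subst ha₀
    rw [quad_mul_mul_add, sextic_inj] at hp
    obtain ⟨-, h1, h2, h3, h4, h5, -⟩ := hp
    have hm : a₁ ≠ 0 := by rintro rfl; norm_num at h1
    have hb₀ : b₀ ≠ 0 := by rintro rfl; norm_num at h1
    have hb₂ : b₂ ≠ 0 := by rintro rfl; norm_num at h5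
    have hb₁ : b₁ = -a₁ / 2 := by
      have : a₁ * b₀ * (2 * b₁ + a₁) = 0 := by linear_combination -h2
      linear_combination (mul_eq_zero.1 this).resolve_left (mul_ne_zero hm hb₀) / 2
    have he : b₂ = b₀ * (b₂ / b₀) := by field_simp
    have he2 : (b₂ / b₀) ^ 2 = 1 := by
      rw [div_pow, div_eq_one_iff_eq (pow_ne_zero 2 hb₀)]
      apply mul_left_cancel₀ hm
      linear_combination h1 - h5
    refine ⟨b₂ / b₀, he2, ?_, span_quad_eq_axisPlane hm hb₀ he⟩
    generalize b₂ / b₀ = e at he he2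
    subst he hb₁
    intro hk
    apply hm
    have : a₁ ^ 3 = 0 := by linear_combination 4 * h3 - 4 * hk - 8 * e * h1
    exact pow_eq_zero_iff (by norm_num) |>.1 this
  right
  -- Since `y` does not divide `a`, it divides `b` or `a + b`; replacing `b` by `-(a + b)` if
  -- necessary, it divides `b`.
  obtain ⟨b₁, b₂, hb₂, hp, hspan⟩ : ∃ c₁ c₂ : ℂ, c₂ ≠ 0 ∧
      sextic 0 1 0 k 0 1 0 =
        quad a₀ a₁ 0 * quad 0 c₁ c₂ * (quad a₀ a₁ 0 + quad 0 c₁ c₂) ∧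
      Submodule.span ℂ {quad a₀ a₁ 0, quad b₀ b₁ b₂} =
        Submodule.span ℂ {quad a₀ a₁ 0, quad 0 c₁ c₂} := by
    have h := hp
    rw [quad_mul_mul_add, sextic_inj] at h
    have hb₂ : b₂ ≠ 0 := by
      rintro rfl
      have := h.2.2.2.2.2.1
      norm_num at this
    rcases mul_eq_zero.1 h.1.symm with h0 | h0
    · obtain rfl := (mul_eq_zero.1 h0).resolve_left ha₀
      exact ⟨b₁, b₂, hb₂, hp, rfl⟩
    · have e1 : (-1 : ℂ) • quad a₀ a₁ 0 + (-1 : ℂ) • quad b₀ b₁ b₂ =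
          quad 0 (-(a₁ + b₁)) (-b₂) := by
        rw [smul_quad, smul_quad, quad_add]
        congr 1
        · linear_combination -h0
        · ring
        · ring
      refine ⟨-(a₁ + b₁), -b₂, neg_ne_zero.2 hb₂, ?_, ?_⟩
      · rw [← e1, hp]
        simp only [neg_smul, one_smul]
        ring
      · rw [← e1, ← span_combine (quad a₀ a₁ 0) (quad b₀ b₁ b₂) (a := 1) (b := 0) (c := -1)
          (d := -1) (by norm_num)]
        simp
  rw [hspan, span_quad_eq_crossPlane ha₀ hb₂]
  rw [quad_mul_mul_add, sextic_inj] at hp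
  obtain ⟨-, h1, h2, h3, h4, h5, -⟩ := hp
  have hb₁ : b₁ ≠ 0 := by rintro rfl; norm_num at h1
  have ha₁ : a₁ ≠ 0 := by rintro rfl; norm_num at h5
  have e1 : a₀ * b₂ + 2 * a₁ * b₁ + b₁ ^ 2 = 0 := by
    have : a₀ * (a₀ * b₂ + 2 * a₁ * b₁ + b₁ ^ 2) = 0 := by linear_combination -h2
    exact (mul_eq_zero.1 this).resolve_left ha₀
  have e2 : a₀ * b₂ + 2 * a₁ * b₁ + a₁ ^ 2 = 0 := by
    have : b₂ * (a₀ * b₂ + 2 * a₁ * b₁ + a₁ ^ 2) = 0 := by linear_combination -h4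
    exact (mul_eq_zero.1 this).resolve_left hb₂
  -- The vanishing coefficients of `x⁴y²` and `x²y⁴` differ only by `b₁²` against `a₁²`; the two
  -- signs give the hexagonal and the octahedral case.
  have e3 : (b₁ - a₁) * (b₁ + a₁) = 0 := by linear_combination e1 - e2
  rcases mul_eq_zero.1 e3 with e3 | e3
  · right
    obtain rfl : b₁ = a₁ := sub_eq_zero.1 e3
    have e4 : a₀ * b₂ = -3 * b₁ ^ 2 := by linear_combination e1
    have e5 : 9 * b₁ ^ 6 = 1 := by
      linear_combination -h1 - a₀ ^ 2 * b₁ * h5 - b₁ ^ 2 * (a₀ * b₂ - 3 * b₁ ^ 2) * e4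
    have e6 : k = -10 * b₁ ^ 3 := by linear_combination h3 + 4 * b₁ * e4
    have hr2 : (b₁ / a₀) ^ 2 = b₁ ^ 3 := by
      rw [div_pow, div_eq_iff (pow_ne_zero 2 ha₀)]
      linear_combination b₁ ^ 2 * h1
    refine ⟨by rw [e6]; linear_combination 100 * e5, b₁ / a₀, by rw [hr2, e6]; ring, ?_⟩
    congr 1
    field_simp
    linear_combination e4
  · left
    obtain rfl : b₁ = -a₁ := by linear_combination e3
    have e4 : a₀ * b₂ = a₁ ^ 2 := by linear_combination e1
    have e5 : a₁ ^ 6 = -1 := by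
      linear_combination h1 - a₀ ^ 2 * a₁ * h5 - a₁ ^ 2 * (a₀ * b₂ + a₁ ^ 2) * e4
    have e6 : k = 0 := by linear_combination h3
    have hr2 : (a₁ / a₀) ^ 2 = -a₁ ^ 3 := by
      rw [div_pow, div_eq_iff (pow_ne_zero 2 ha₀)]
      linear_combination a₁ ^ 2 * h1
    refine ⟨e6, a₁ / a₀, ?_, ?_⟩
    · rw [show (a₁ / a₀) ^ 4 = ((a₁ / a₀) ^ 2) ^ 2 by ring, hr2]
      linear_combination e5
    · congr 1
      field_simp
      linear_combination e4

lemma encard_roots {n : ℕ} (hn : n ≠ 0) {c : ℂ} (hc : c ≠ 0) :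
    {z : ℂ | z ^ n = c}.encard = n := by
  obtain ⟨w, hw⟩ := IsAlgClosed.exists_pow_nat_eq c (Nat.pos_of_ne_zero hn)
  have hprim := Complex.isPrimitiveRoot_exp n hn
  have : {z : ℂ | z ^ n = c} = ((Polynomial.nthRoots n c).toFinset : Set ℂ) := by
    ext z
    simp [Polynomial.mem_nthRoots (Nat.pos_of_ne_zero hn)]
  rw [this, Set.encard_coe_eq_coe_finsetCard, Multiset.toFinset_card_of_nodup
    (hprim.nthRoots_nodup hc), hprim.card_nthRoots, if_pos ⟨w, hw⟩]

lemma planes_axisSextic_eq {k : ℂ} : planes (axisSextic k) =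
    axisPlane '' {e | e ^ 2 = 1 ∧ k ≠ 2 * e} ∪
    ((fun r => crossPlane r (-1 / r)) '' {r | k = 0 ∧ r ^ 4 = -1} ∪
    (fun r => crossPlane r (-1 / (3 * r))) '' {r | 9 * k ^ 2 = 100 ∧ 10 * r ^ 2 = -k}) := by
  ext V
  constructor
  · intro hV
    rcases planes_axisSextic_cases hV with ⟨e, he, hk, rfl⟩ | ⟨hk, r, hr, rfl⟩ | ⟨hk, r, hr, rfl⟩
    · exact Or.inl ⟨e, ⟨he, hk⟩, rfl⟩
    · exact Or.inr (Or.inl ⟨r, ⟨hk, hr⟩, rfl⟩)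
    · exact Or.inr (Or.inr ⟨r, ⟨hk, hr⟩, rfl⟩)
  · rintro (⟨e, ⟨he, hk⟩, rfl⟩ | ⟨r, ⟨rfl, hr⟩, rfl⟩ | ⟨r, ⟨hk, hr⟩, rfl⟩)
    · exact axisPlane_mem_planes he hk
    · exact crossPlane_mem_planes_of_octahedral hr
    · exact crossPlane_mem_planes_of_hexagonal hk hr

lemma N_axisSextic (k : ℂ) : N (axisSextic k) =
    {e : ℂ | e ^ 2 = 1 ∧ k ≠ 2 * e}.encard + ({r : ℂ | k = 0 ∧ r ^ 4 = -1}.encard +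
      {r : ℂ | 9 * k ^ 2 = 100 ∧ 10 * r ^ 2 = -k}.encard) := by
  rw [N_eq_encard_planes, planes_axisSextic_eq, Set.encard_union_eq, Set.encard_union_eq,
    axisPlane_injective.encard_image, Set.InjOn.encard_image, Set.InjOn.encard_image]
  · exact fun _ _ _ _ h => crossPlane_injective_left h
  · exact fun _ _ _ _ h => crossPlane_injective_left h
  · rw [Set.disjoint_left]
    rintro _ ⟨r, ⟨rfl, hr⟩, rfl⟩ ⟨s, ⟨hs, -⟩, -⟩
    norm_num at hs
  · rw [Set.disjoint_left]
    rintro _ ⟨e, -, rfl⟩ (⟨r, -, h⟩ | ⟨r, -, h⟩)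
    · exact crossPlane_ne_axisPlane h
    · exact crossPlane_ne_axisPlane h

lemma encard_axis_of_ne {k : ℂ} (h1 : k ≠ 2) (h2 : k ≠ -2) :
    {e : ℂ | e ^ 2 = 1 ∧ k ≠ 2 * e}.encard = 2 := by
  suffices h : {e : ℂ | e ^ 2 = 1 ∧ k ≠ 2 * e} = {e | e ^ 2 = 1} by
    rw [h, encard_roots two_ne_zero one_ne_zero, Nat.cast_two]
  ext e
  simp only [Set.mem_ofPred_eq, and_iff_left_iff_imp]
  intro he
  rcases sq_eq_sq_iff_eq_or_eq_neg.1 (he.trans (one_pow 2).symm) with rfl | rfl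
  · simpa using h1
  · simpa using h2

lemma N_axisSextic_zero : N (axisSextic 0) = 6 := by
  rw [N_axisSextic, encard_axis_of_ne (by norm_num) (by norm_num)]
  simp only [true_and]
  rw [encard_roots (by norm_num) (by norm_num)]
  norm_num

lemma N_axisSextic_hexagonal {k : ℂ} (hk : 9 * k ^ 2 = 100) : N (axisSextic k) = 4 := by
  have hk0 : k ≠ 0 := by rintro rfl; norm_num at hk
  rw [N_axisSextic, encard_axis_of_ne (by rintro rfl; norm_num at hk)
    (by rintro rfl; norm_num at hk)]
  have : {r : ℂ | 9 * k ^ 2 = 100 ∧ 10 * r ^ 2 = -k} = {r : ℂ | r ^ 2 = -k / 10} := by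
    ext r
    simp only [hk, true_and, Set.mem_ofPred_eq]
    constructor
    · intro h; linear_combination h / 10
    · intro h; linear_combination h * 10
  rw [this, encard_roots (by norm_num) (by simp [hk0])]
  simp only [hk0, false_and, Set.ofPred_false, Set.encard_empty]
  norm_num

lemma N_axisSextic_of_ne {k : ℂ} (h0 : k ≠ 0) (h1 : k ≠ 2) (h2 : k ≠ -2)
    (h3 : 9 * k ^ 2 ≠ 100) : N (axisSextic k) = 2 := by
  rw [N_axisSextic, encard_axis_of_ne h1 h2]
  simp [h0, h3]

/-- The sextic is `xy(x² + e y²)²`, and only the axis plane with parameter `-e` survives. -/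
lemma N_axisSextic_double {e : ℂ} (he : e ^ 2 = 1) : N (axisSextic (2 * e)) = 1 := by
  have he0 : e ≠ 0 := by rintro rfl; norm_num at he
  rw [N_axisSextic]
  have h1 : {z : ℂ | z ^ 2 = 1 ∧ 2 * e ≠ 2 * z} = {-e} := by
    ext z
    simp only [Set.mem_ofPred_eq, Set.mem_singleton_iff]
    constructor
    · rintro ⟨hz, hne⟩
      have : (z + e) * (z - e) = 0 := by linear_combination hz - he
      rcases mul_eq_zero.1 this with h | h
      · linear_combination h
      · exact absurd (by linear_combination -2 * h) hne
    · rintro rfl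
      refine ⟨by linear_combination he, fun h => he0 ?_⟩
      linear_combination h / 4
  have h2 : (9 * (2 * e) ^ 2 : ℂ) ≠ 100 := by
    rw [mul_pow, he]; norm_num
  rw [h1, Set.encard_singleton]
  simp [he0, h2]

/-! ### The values of `N` on the family `A_t` -/

lemma gl_isotropic_ne_zero {c : ℂ} (hc : c ≠ 0) :
    c * -(c * Complex.I) - c * Complex.I * c ≠ 0 := by
  have : c * -(c * Complex.I) - c * Complex.I * c = -2 * Complex.I * c ^ 2 := by ring
  rw [this]
  simp [hc]

/-- The change of variables `x ↦ c (x + i y)`, `y ↦ c (x - i y)`. -/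
noncomputable def isotropic (c : ℂ) (hc : c ≠ 0) : Matrix.GeneralLinearGroup (Fin 2) ℂ :=
  gl c (c * Complex.I) c (-(c * Complex.I)) (gl_isotropic_ne_zero hc)

lemma compHom_isotropic_X_zero {c : ℂ} (hc : c ≠ 0) :
    compHom (isotropic c hc) (X 0) = C c * (X 0 + C Complex.I * X 1) := by
  rw [compHom_X, isotropic, coe_gl]
  simp
  ring

lemma compHom_isotropic_X_one {c : ℂ} (hc : c ≠ 0) :
    compHom (isotropic c hc) (X 1) = C c * (X 0 - C Complex.I * X 1) := by
  rw [compHom_X, isotropic, coe_gl]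
  simp
  ring

lemma C_I_sq : (C Complex.I ^ 2 : Poly) = -1 := by
  rw [← map_pow, Complex.I_sq, map_neg, map_one]

lemma comp_axisSextic_isotropic (k : ℂ) {c : ℂ} (hc : c ≠ 0) :
    comp (axisSextic k) (isotropic c hc) = C (c ^ 6) * ((X 0 ^ 2 + X 1 ^ 2) *
      (4 * (X 0 ^ 2 - X 1 ^ 2) ^ 2 + (C k - 2) * (X 0 ^ 2 + X 1 ^ 2) ^ 2)) := by
  have h1 : ((X 0 + C Complex.I * X 1) * (X 0 - C Complex.I * X 1) : Poly) =
      X 0 ^ 2 + X 1 ^ 2 := by linear_combination -(X 1) ^ 2 * C_I_sq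
  have h2 : ((X 0 + C Complex.I * X 1) ^ 2 + (X 0 - C Complex.I * X 1) ^ 2 : Poly) =
      2 * (X 0 ^ 2 - X 1 ^ 2) := by linear_combination 2 * (X 1) ^ 2 * C_I_sq
  have h3 : axisSextic k =
      X 0 * X 1 * ((X 0 ^ 2 + X 1 ^ 2) ^ 2 + (C k - 2) * (X 0 * X 1) ^ 2) := by
    simp only [axisSextic, sextic, map_zero, map_one]; ring
  rw [comp_eq_compHom, h3]
  simp only [map_mul, map_add, map_sub, map_pow, compHom_C, map_ofNat, compHom_isotropic_X_zero,
    compHom_isotropic_X_one]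
  rw [← h1]
  generalize hu : (X 0 + C Complex.I * X 1 : Poly) = u at *
  generalize hv : (X 0 - C Complex.I * X 1 : Poly) = v at *
  linear_combination C c ^ 6 * u * v * (u ^ 2 + v ^ 2 + 2 * (X 0 ^ 2 - X 1 ^ 2)) * h2

lemma similar_A_axisSextic {t : ℂ} (ht : t ≠ 3) :
    Similar (A t) (axisSextic ((10 + 2 * t) / (3 - t))) := by
  have ht' : 3 - t ≠ 0 := fun h => ht (by linear_combination -h)
  -- The transformed sextic has outer coefficients `c⁶(k + 2)` and inner ones `c⁶(3k - 10)`. Setting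
  -- these to `1` and `t` gives `k` and `c⁶ = 1/(k + 2) = (3 - t)/16`.
  obtain ⟨c, hc⟩ := IsAlgClosed.exists_pow_nat_eq ((3 - t) / 16) (n := 6) (by norm_num)
  have hc0 : c ≠ 0 := by
    rintro rfl
    apply ht'
    linear_combination -16 * hc
  refine ⟨isotropic c hc0, ?_⟩
  rw [comp_axisSextic_isotropic]
  have e1 : t = 3 - 16 * c ^ 6 := by linear_combination 16 * hc
  have e2 : c ^ 6 * ((10 + 2 * t) / (3 - t)) = 1 - 2 * c ^ 6 := by
    rw [hc]
    field_simp
    ring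
  have e1' : (C t : Poly) = 3 - 16 * C (c ^ 6) := by
    simpa only [map_sub, map_mul, map_ofNat] using congrArg (C : ℂ → Poly) e1
  have e2' : (C (c ^ 6) * C ((10 + 2 * t) / (3 - t)) : Poly) = 1 - 2 * C (c ^ 6) := by
    rw [← map_mul, e2]; simp only [map_sub, map_mul, map_one, map_ofNat]
  rw [A, e1']
  linear_combination -(X 0 ^ 2 + X 1 ^ 2) ^ 3 * e2'

lemma similar_A_three : Similar (A 3) (sextic 0 0 0 1 0 0 0) := by
  refine ⟨isotropic 1 one_ne_zero, ?_⟩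
  have h1 : ((X 0 + C Complex.I * X 1) * (X 0 - C Complex.I * X 1) : Poly) =
      X 0 ^ 2 + X 1 ^ 2 := by linear_combination -(X 1) ^ 2 * C_I_sq
  have h3 : sextic 0 0 0 1 0 0 0 = (X 0 * X 1) ^ 3 := by
    simp only [sextic, map_zero, map_one]; ring
  rw [comp_eq_compHom, h3]
  simp only [map_mul, map_pow, compHom_isotropic_X_zero, compHom_isotropic_X_one, map_one, one_mul]
  rw [h1, A, map_ofNat]
  ring

/-- If `x` divides all three factors, the cofactors multiply to `y³`, so all factors are multiples
of `xy`, against independence. Otherwise `x³` would divide a single nonzero quadratic. -/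
lemma planes_cube_eq_empty : planes (sextic 0 0 0 1 0 0 0) = ∅ := by
  rw [Set.eq_empty_iff_forall_notMem]
  intro V hV
  obtain ⟨a₀, a₁, b₀, b₁, b₂, hd, hp, rfl⟩ := exists_basis_of_mem_planes hV
  rw [quad_mul_mul_add, sextic_inj] at hp
  obtain ⟨h0, h1, h2, h3, h4, h5, -⟩ := hp
  by_cases hb₂ : b₂ = 0
  · subst hb₂
    have h3' : a₁ * b₁ * (a₁ + b₁) = 1 := by linear_combination -h3
    have ha₁ : a₁ ≠ 0 := by rintro rfl; norm_num at h3'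
    have hb₁ : b₁ ≠ 0 := by rintro rfl; norm_num at h3'
    have hab : a₁ + b₁ ≠ 0 := by intro h; rw [h] at h3'; norm_num at h3'
    rcases mul_eq_zero.1 h0.symm with h | h
    · rcases mul_eq_zero.1 h with rfl | rfl
      · have : b₀ ^ 2 * a₁ = 0 := by linear_combination -h1
        have hb₀ : b₀ = 0 := by simpa [ha₁] using this
        subst hb₀
        have := distinct_iff.1 hd b₁ (-a₁) (by
          rw [smul_quad, smul_quad, quad_add, ← quad_zero]; congr 1 <;> ring)
        exact hb₁ this.1
      · have : a₀ ^ 2 * b₁ = 0 := by linear_combination -h1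
        have ha₀ : a₀ = 0 := by simpa [hb₁] using this
        subst ha₀
        have := distinct_iff.1 hd b₁ (-a₁) (by
          rw [smul_quad, smul_quad, quad_add, ← quad_zero]; congr 1 <;> ring)
        exact hb₁ this.1
    · obtain rfl : b₀ = -a₀ := by linear_combination h
      have : a₀ ^ 2 * (a₁ + b₁) = 0 := by linear_combination h1
      have ha₀ : a₀ = 0 := by simpa [hab] using this
      subst ha₀
      have := distinct_iff.1 hd b₁ (-a₁) (by
        rw [smul_quad, smul_quad, quad_add, ← quad_zero]; congr 1 <;> ring)
      exact hb₁ this.1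
  · have ha₁ : a₁ = 0 := by
      have : a₁ * b₂ ^ 2 = 0 := by linear_combination -h5
      simpa [hb₂] using this
    subst ha₁
    have ha₀ : a₀ = 0 := by
      have : a₀ * b₂ ^ 2 = 0 := by linear_combination -h4
      simpa [hb₂] using this
    subst ha₀
    exact hd.ne_zero_left quad_zero

lemma N_A_of_ne {t : ℂ} (ht : t ≠ 3) : N (A t) = N (axisSextic ((10 + 2 * t) / (3 - t))) :=
  (similar_A_axisSextic ht).N_eq

lemma N_A_three : N (A 3) = 0 := by
  rw [similar_A_three.N_eq, N_eq_encard_planes, planes_cube_eq_empty, Set.encard_empty]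

lemma N_A_neg_one : N (A (-1)) = 1 := by
  rw [N_A_of_ne (by norm_num), ← N_axisSextic_double (one_pow 2)]
  norm_num

lemma N_A_zero : N (A 0) = 4 := by
  rw [N_A_of_ne (by norm_num), N_axisSextic_hexagonal (by norm_num)]

lemma N_A_fifteen : N (A 15) = 4 := by
  rw [N_A_of_ne (by norm_num), N_axisSextic_hexagonal (by norm_num)]

lemma N_A_neg_five : N (A (-5)) = 6 := by
  rw [N_A_of_ne (by norm_num), ← N_axisSextic_zero]
  norm_num

lemma N_A_eq_two {t : ℂ} (ht : t ∉ ({3, -1, 0, 15, -5} : Set ℂ)) : N (A t) = 2 := by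
  simp only [Set.mem_insert_iff, Set.mem_singleton_iff, not_or] at ht
  obtain ⟨h1, h2, h3, h4, h5⟩ := ht
  have h3t : 3 - t ≠ 0 := fun h => h1 (by linear_combination -h)
  rw [N_A_of_ne h1]
  apply N_axisSextic_of_ne
  · rw [Ne, div_eq_iff h3t]
    exact fun h => h5 (by linear_combination h / 2)
  · rw [Ne, div_eq_iff h3t]
    exact fun h => h2 (by linear_combination h / 4)
  -- The value `k = -2` corresponds to no finite `t`.
  · rw [Ne, div_eq_iff h3t]
    intro h
    have : (16 : ℂ) = 0 := by linear_combination h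
    norm_num at this
  · rw [Ne, div_pow, ← mul_div_assoc, div_eq_iff (pow_ne_zero 2 h3t)]
    intro h
    have : t * (t - 15) = 0 := by linear_combination -h / 64
    rcases mul_eq_zero.1 this with h | h
    · exact h3 h
    · exact h4 (sub_eq_zero.1 h)

/-! ### Sextics with exactly two representations -/

lemma compHom_sextic_diagonal (M : Matrix.GeneralLinearGroup (Fin 2) ℂ) {a d : ℂ}
    (hM : (M : Matrix (Fin 2) (Fin 2) ℂ) = !![a, 0; 0, d]) (c₀ c₁ c₂ c₃ : ℂ) :
    compHom M (sextic c₀ 0 c₁ 0 c₂ 0 c₃) =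
      sextic (c₀ * a ^ 6) 0 (c₁ * a ^ 4 * d ^ 2) 0 (c₂ * a ^ 2 * d ^ 4) 0 (c₃ * d ^ 6) := by
  have h0 : compHom M (X 0) = C a * X 0 := by rw [compHom_X, hM]; simp
  have h1 : compHom M (X 1) = C d * X 1 := by rw [compHom_X, hM]; simp
  simp only [sextic, map_add, map_mul, map_pow, compHom_C, h0, h1, map_zero]
  ring

lemma compHom_sextic_antidiagonal (M : Matrix.GeneralLinearGroup (Fin 2) ℂ) {b c : ℂ}
    (hM : (M : Matrix (Fin 2) (Fin 2) ℂ) = !![0, b; c, 0]) (c₀ c₁ c₂ c₃ : ℂ) :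
    compHom M (sextic c₀ 0 c₁ 0 c₂ 0 c₃) =
      sextic (c₃ * c ^ 6) 0 (c₂ * c ^ 4 * b ^ 2) 0 (c₁ * c ^ 2 * b ^ 4) 0 (c₀ * b ^ 6) := by
  have h0 : compHom M (X 0) = C b * X 1 := by rw [compHom_X, hM]; simp
  have h1 : compHom M (X 1) = C c * X 0 := by rw [compHom_X, hM]; simp
  simp only [sextic, map_add, map_mul, map_pow, compHom_C, h0, h1, map_zero]
  ring

/-- The plane spanned by `x²` and `y²`. -/
noncomputable def squarePlane : Submodule ℂ Poly :=
  Submodule.span ℂ {quad 1 0 0, quad 0 0 1}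

lemma quad_mem_squarePlane {a b c : ℂ} : quad a b c ∈ squarePlane ↔ b = 0 := by
  rw [squarePlane, Submodule.mem_span_pair]
  simp only [smul_quad, quad_add, quad_inj]
  constructor
  · rintro ⟨u, v, -, h, -⟩
    rw [← h]; ring
  · intro h
    exact ⟨a, c, by ring, by rw [h]; ring, by ring⟩

lemma exists_eq_sextic_of_squarePlane_mem {p : Poly} (h : squarePlane ∈ planes p) :
    ∃ c₀ c₁ c₂ c₃ : ℂ, p = sextic c₀ 0 c₁ 0 c₂ 0 c₃ := by
  obtain ⟨a, b, ha, hb, -, rfl, hs⟩ := h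
  obtain ⟨a₀, a₁, a₂, rfl⟩ := exists_eq_quad ha
  obtain ⟨b₀, b₁, b₂, rfl⟩ := exists_eq_quad hb
  obtain rfl : a₁ = 0 := by
    rw [← quad_mem_squarePlane (a := a₀) (c := a₂), hs]
    exact Submodule.subset_span (by simp)
  obtain rfl : b₁ = 0 := by
    rw [← quad_mem_squarePlane (a := b₀) (c := b₂), hs]
    exact Submodule.subset_span (by simp)
  rw [quad_mul_mul_add]
  refine ⟨_, _, _, _, sextic_inj.2 ⟨rfl, by ring, rfl, by ring, rfl, by ring, rfl⟩⟩

lemma map_squarePlane_diagonal (M : Matrix.GeneralLinearGroup (Fin 2) ℂ) {a d : ℂ}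
    (hM : (M : Matrix (Fin 2) (Fin 2) ℂ) = !![a, 0; 0, d]) (ha : a ≠ 0) (hd : d ≠ 0) :
    squarePlane.map (compHom M).toLinearMap = squarePlane := by
  rw [squarePlane, map_span_pair, compHom_quad M hM, compHom_quad M hM,
    ← span_combine (quad 1 0 0) (quad 0 0 1) (a := a ^ 2) (b := 0) (c := 0) (d := d ^ 2)
      (by simp [ha, hd])]
  simp only [smul_quad, quad_add]
  simp

lemma map_squarePlane_antidiagonal (M : Matrix.GeneralLinearGroup (Fin 2) ℂ) {b c : ℂ}
    (hM : (M : Matrix (Fin 2) (Fin 2) ℂ) = !![0, b; c, 0]) (hb : b ≠ 0) (hc : c ≠ 0) :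
    squarePlane.map (compHom M).toLinearMap = squarePlane := by
  rw [squarePlane, map_span_pair, compHom_quad M hM, compHom_quad M hM,
    ← span_combine (quad 1 0 0) (quad 0 0 1) (a := 0) (b := b ^ 2) (c := c ^ 2) (d := 0)
      (by simp [hb, hc])]
  simp only [smul_quad, quad_add]
  simp

/-- The reflection `y ↦ -y`. -/
noncomputable def reflection : Matrix.GeneralLinearGroup (Fin 2) ℂ := gl 1 0 0 (-1) (by norm_num)

lemma comp_reflection {p : Poly} (h : squarePlane ∈ planes p) : compHom reflection p = p := by
  obtain ⟨c₀, c₁, c₂, c₃, rfl⟩ := exists_eq_sextic_of_squarePlane_mem h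
  rw [compHom_sextic_diagonal reflection (coe_gl _ _ _ _ _), sextic_inj]
  refine ⟨?_, rfl, ?_, rfl, ?_, rfl, ?_⟩ <;> ring

lemma map_map (M M' : Matrix.GeneralLinearGroup (Fin 2) ℂ) (V : Submodule ℂ Poly) :
    (V.map (compHom M).toLinearMap).map (compHom M').toLinearMap =
      V.map (compHom (M * M')).toLinearMap := by
  have h : (compHom M').toLinearMap.comp (compHom M).toLinearMap =
    (compHom (M * M')).toLinearMap := LinearMap.ext fun f => compHom_compHom M M' f
  rw [← Submodule.map_comp, h]

lemma map_injective (M : Matrix.GeneralLinearGroup (Fin 2) ℂ) :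
    Function.Injective fun V : Submodule ℂ Poly => V.map (compHom M).toLinearMap :=
  Submodule.map_injective_of_injective (f := (compHom M).toLinearMap) (compHom_injective M)

/-- If `p` has exactly two representations, each representing plane can be moved to
`⟨x², y²⟩`. -/
lemma exists_map_eq_squarePlane {p : Poly} (hN : N p = 2) {V : Submodule ℂ Poly}
    (hV : V ∈ planes p) : ∃ M : Matrix.GeneralLinearGroup (Fin 2) ℂ,
      V.map (compHom M).toLinearMap = squarePlane := by
  have hV' := hV
  obtain ⟨a, b, ha, hb, hd, -, rfl⟩ := hV
  obtain ⟨M, h | h⟩ := exists_map_eq_normalForm ha hb hd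
  · exfalso
    have h1 := map_mem_planes hV' M
    rw [h] at h1
    have h2 := planes_eq_singleton_of_degenerate h1
    rw [← N_comp p M, N_eq_encard_planes, h2, Set.encard_singleton] at hN
    norm_num at hN
  · exact ⟨M, h⟩

/-- If `⟨x², y²⟩` is preserved by the involution fixing another plane `W` pointwise, then this
involution exchanges the coordinate axes. -/
lemma exists_antidiagonal {M S : Matrix.GeneralLinearGroup (Fin 2) ℂ}
    (hSM : S * M = M * reflection)
    (hM : squarePlane.map (compHom M).toLinearMap ≠ squarePlane)
    (hS : squarePlane.map (compHom S).toLinearMap = squarePlane) :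
    ∃ b c : ℂ, b * c = 1 ∧ (S : Matrix (Fin 2) (Fin 2) ℂ) = !![0, b; c, 0] := by
  obtain ⟨a, b, c, d, hS'⟩ : ∃ a b c d : ℂ, (S : Matrix (Fin 2) (Fin 2) ℂ) = !![a, b; c, d] :=
    ⟨_, _, _, _, Matrix.eta_fin_two _⟩
  obtain ⟨p, q, r, s, hM'⟩ : ∃ p q r s : ℂ, (M : Matrix (Fin 2) (Fin 2) ℂ) = !![p, q; r, s] :=
    ⟨_, _, _, _, Matrix.eta_fin_two _⟩
  have hSdet : a * d - b * c ≠ 0 := by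
    have := (Matrix.isUnit_iff_isUnit_det _).1 S.isUnit
    rw [hS', Matrix.det_fin_two_of] at this
    exact this.ne_zero
  have hMdet : p * s - q * r ≠ 0 := by
    have := (Matrix.isUnit_iff_isUnit_det _).1 M.isUnit
    rw [hM', Matrix.det_fin_two_of] at this
    exact this.ne_zero
  have hmul := congrArg (fun T : Matrix.GeneralLinearGroup (Fin 2) ℂ =>
    (T : Matrix (Fin 2) (Fin 2) ℂ)) hSM
  simp only [Units.val_mul, hS', hM', reflection, coe_gl] at hmul
  have e00 : a * p + b * r = p := by simpa [Matrix.mul_apply] using congrFun₂ hmul 0 0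
  have e01 : a * q + b * s = -q := by simpa [Matrix.mul_apply] using congrFun₂ hmul 0 1
  have e10 : c * p + d * r = r := by simpa [Matrix.mul_apply] using congrFun₂ hmul 1 0
  have e11 : c * q + d * s = -s := by simpa [Matrix.mul_apply] using congrFun₂ hmul 1 1
  -- `S` sends `x²` to `(ax + by)²`, whose mixed term must vanish.
  have hab : a * b = 0 := by
    have h1 : compHom S (quad 1 0 0) ∈ squarePlane := by
      rw [← hS]
      exact Submodule.mem_map_of_mem (f := (compHom S).toLinearMap)
        (quad_mem_squarePlane.2 rfl)
    rw [compHom_quad S hS', quad_mem_squarePlane] at h1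
    linear_combination h1 / 2
  have hcd : c * d = 0 := by
    have h1 : compHom S (quad 0 0 1) ∈ squarePlane := by
      rw [← hS]
      exact Submodule.mem_map_of_mem (f := (compHom S).toLinearMap)
        (quad_mem_squarePlane.2 rfl)
    rw [compHom_quad S hS', quad_mem_squarePlane] at h1
    linear_combination h1 / 2
  rcases mul_eq_zero.1 hab with rfl | rfl
  · have hc : c ≠ 0 := by rintro rfl; simp at hSdet
    obtain rfl : d = 0 := (mul_eq_zero.1 hcd).resolve_left hc
    refine ⟨b, c, ?_, hS'⟩
    have hp : p ≠ 0 := by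
      rintro rfl
      have : r = 0 := by linear_combination -e10
      simp [this] at hMdet
    apply mul_right_cancel₀ hp
    linear_combination e00 + b * e10
  -- The columns of `M` are eigenvectors of `S` for `1` and `-1`. If `S` is diagonal they lie on the
  -- axes, so `M` preserves `⟨x², y²⟩`.
  · exfalso
    have hd : d ≠ 0 := by rintro rfl; simp at hSdet
    obtain rfl : c = 0 := (mul_eq_zero.1 hcd).resolve_right hd
    apply hM
    by_cases hp : p = 0
    · subst hp
      have hq : q ≠ 0 := by rintro rfl; simp at hMdet
      have hr : r ≠ 0 := by rintro rfl; simp at hMdet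
      have hd1 : d = 1 := mul_right_cancel₀ hr (by linear_combination e10)
      have hs : s = 0 := by rw [hd1] at e11; linear_combination e11 / 2
      rw [hs] at hM'
      exact map_squarePlane_antidiagonal M hM' hq hr
    · have ha1 : a = 1 := mul_right_cancel₀ hp (by linear_combination e00)
      have hq : q = 0 := by rw [ha1] at e01; linear_combination e01 / 2
      subst hq
      have hs : s ≠ 0 := by rintro rfl; simp at hMdet
      have hd1 : d = -1 := mul_right_cancel₀ hs (by linear_combination e11)
      have hr : r = 0 := by rw [hd1] at e10; linear_combination -e10 / 2
      rw [hr] at hM'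
      exact map_squarePlane_diagonal M hM' hp hs

lemma planes_zero : planes 0 = ∅ := by
  rw [Set.eq_empty_iff_forall_notMem]
  rintro V ⟨a, b, -, -, hd, hp, -⟩
  rcases mul_eq_zero.1 hp.symm with h | h
  · rcases mul_eq_zero.1 h with h | h
    · exact hd.ne_zero_left h
    · exact hd.ne_zero_right h
  · have := distinct_iff.1 hd 1 1 (by rw [one_smul, one_smul, h])
    exact one_ne_zero this.1

lemma exists_similar_A_of_symmetric {c d : ℂ} (hN : N (sextic c 0 d 0 d 0 c) = 2) :
    ∃ t, Similar (sextic c 0 d 0 d 0 c) (A t) := by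
  by_cases hc : c = 0
  · exfalso
    subst hc
    by_cases hd : d = 0
    · subst hd
      have : sextic 0 0 0 0 0 0 0 = 0 := by simp [sextic]
      rw [this, N_eq_encard_planes, planes_zero, Set.encard_empty] at hN
      norm_num at hN
    -- The sextic `d x²y²(x² + y²)` is the limit `t → ∞` of the family. It is equivalent to
    -- `axisSextic (-2)`, which has only one plane.
    obtain ⟨l, hl⟩ := IsAlgClosed.exists_pow_nat_eq (-d / 16) (n := 6) (by norm_num)
    have hl0 : l ≠ 0 := by
      rintro rfl
      apply hd
      linear_combination 16 * hl
    have hd' : d = -16 * l ^ 6 := by rw [hl]; ring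
    have hs : Similar (sextic 0 0 d 0 d 0 0) (axisSextic (2 * -1)) := by
      refine ⟨isotropic l hl0, ?_⟩
      rw [comp_axisSextic_isotropic, hd', sextic]
      simp only [map_mul, map_neg, map_ofNat, map_zero, map_one]
      ring
    rw [hs.N_eq, N_axisSextic_double (by norm_num)] at hN
    norm_num at hN
  · obtain ⟨l, hl⟩ := IsAlgClosed.exists_pow_nat_eq c (n := 6) (by norm_num)
    have hl0 : l ≠ 0 := by
      rintro rfl
      apply hc
      rw [← hl]; norm_num
    refine ⟨d / c, gl l 0 0 l (by simp [hl0]), ?_⟩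
    have hA : A (d / c) = sextic 1 0 (d / c) 0 (d / c) 0 1 := by
      simp only [A, sextic, map_zero, map_one]; ring
    rw [hA, comp_eq_compHom, compHom_sextic_diagonal _ (coe_gl _ _ _ _ _), sextic_inj]
    have h1 : d / c * l ^ 6 = d := by rw [hl]; field_simp
    refine ⟨by rw [hl, one_mul], rfl, ?_, rfl, ?_, rfl, by rw [hl, one_mul]⟩
    · linear_combination -h1
    · linear_combination -h1

lemma exists_similar_A_of_N_eq_two {p : Poly} (hN : N p = 2) : ∃ t, Similar p (A t) := by
  obtain ⟨V, V', -, hVp⟩ := Set.encard_eq_two.1 ((N_eq_encard_planes p).symm.trans hN)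
  obtain ⟨M₁, hM₁⟩ := exists_map_eq_squarePlane hN (V := V) (by rw [hVp]; simp)
  have hq : squarePlane ∈ planes (comp p M₁) := by
    rw [← hM₁]
    exact map_mem_planes (by rw [hVp]; simp) M₁
  have hqN : N (comp p M₁) = 2 := (N_comp p M₁).trans hN
  suffices h : ∃ t, Similar (comp p M₁) (A t) by
    obtain ⟨t, ht⟩ := h
    exact ⟨t, Similar.trans (Similar.symm ⟨M₁, rfl⟩) ht⟩
  generalize comp p M₁ = q at hq hqN
  obtain ⟨W, hW, hWne, hWonly⟩ : ∃ W ∈ planes q, W ≠ squarePlane ∧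
      ∀ U ∈ planes q, U ≠ squarePlane → U = W := by
    obtain ⟨U, W, hUW, hpl⟩ := Set.encard_eq_two.1 ((N_eq_encard_planes q).symm.trans hqN)
    rw [hpl] at hq ⊢
    rcases hq with h | h
    · refine ⟨W, by simp, fun h' => hUW (h.symm.trans h'.symm), ?_⟩
      rintro Z (rfl | rfl) hZ
      · exact absurd h.symm hZ
      · rfl
    · rw [Set.mem_singleton_iff] at h
      refine ⟨U, by simp, fun h' => hUW (h'.trans h), ?_⟩
      rintro Z (rfl | rfl) hZ
      · rfl
      · exact absurd h.symm hZ
  obtain ⟨M, hM⟩ := exists_map_eq_squarePlane hqN hW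
  have hRM : compHom (M * reflection) q = compHom M q := by
    rw [← compHom_compHom]
    exact comp_reflection (hM ▸ map_mem_planes hW M)
  -- `S` is the reflection transported to `W` along `M`: it preserves `q` and fixes `W` pointwise.
  obtain ⟨S, hSM⟩ : ∃ S, S * M = M * reflection :=
    ⟨M * reflection * M⁻¹, by rw [inv_mul_cancel_right]⟩
  have hSq : compHom S q = q := by
    apply compHom_injective M
    rw [compHom_compHom, hSM, hRM]
  have hMne : squarePlane.map (compHom M).toLinearMap ≠ squarePlane := by
    intro h
    exact hWne (map_injective M (hM.trans h.symm))
  have hrefl : squarePlane.map (compHom reflection).toLinearMap = squarePlane :=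
    map_squarePlane_diagonal reflection (coe_gl _ _ _ _ _) one_ne_zero (by norm_num)
  -- As `S` preserves `q`, it permutes the two planes of `q`. It fixes `W`, so it cannot send the
  -- other plane to `W`.
  have hS : squarePlane.map (compHom S).toLinearMap = squarePlane := by
    by_contra hne
    have h1 := map_mem_planes hq S
    rw [comp_eq_compHom, hSq] at h1
    have h2 := hWonly _ h1 hne
    apply hMne
    apply map_injective reflection
    dsimp only
    rw [map_map, ← hSM, ← map_map, h2, hM, hrefl]
  obtain ⟨b, c, hbc, hSbc⟩ := exists_antidiagonal hSM hMne hS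
  obtain ⟨c₀, c₁, c₂, c₃, rfl⟩ := exists_eq_sextic_of_squarePlane_mem hq
  rw [compHom_sextic_antidiagonal S hSbc, sextic_inj] at hSq
  obtain ⟨h0, -, h1, -, h2, -, h3⟩ := hSq
  have hc : c ≠ 0 := by rintro rfl; simp at hbc
  -- Scaling `y` by `c` turns the antidiagonal symmetry with `bc = 1` into the plain swap of `x` and
  -- `y`.
  have hsim : Similar (sextic c₀ 0 (c₁ * c ^ 2) 0 (c₁ * c ^ 2) 0 c₀)
      (sextic c₀ 0 c₁ 0 c₂ 0 c₃) := by
    refine ⟨gl 1 0 0 c (by simpa), ?_⟩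
    rw [comp_eq_compHom, compHom_sextic_diagonal _ (coe_gl _ _ _ _ _), sextic_inj]
    have e2 : b ^ 4 * c ^ 4 = 1 := by rw [← mul_pow, hbc, one_pow]
    refine ⟨by ring, rfl, by ring, rfl, ?_, rfl, by linear_combination -h0⟩
    linear_combination c ^ 4 * h2 - c₁ * c ^ 2 * e2
  obtain ⟨t, ht⟩ := exists_similar_A_of_symmetric (hsim.N_eq.trans hqN)
  exact ⟨t, hsim.symm.trans ht⟩

end BinaryForm

theorem theorem5p4 :
    (∀ p : BinaryForm.Poly, p.IsHomogeneous 6 →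
      (BinaryForm.N p = 2 ↔
        ∃ t : ℂ, t ∉ ({3, -1, 0, 15, -5} : Set ℂ) ∧
          BinaryForm.Similar p (BinaryForm.A t))) ∧
    BinaryForm.N (BinaryForm.A 3) = 0 ∧
    BinaryForm.N (BinaryForm.A (-1)) = 1 ∧
    BinaryForm.N (BinaryForm.A 0) = 4 ∧
    BinaryForm.N (BinaryForm.A 15) = 4 ∧
    BinaryForm.N (BinaryForm.A (-5)) = 6 := by
  refine ⟨fun p _ => ⟨fun hN => ?_, ?_⟩, BinaryForm.N_A_three, BinaryForm.N_A_neg_one,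
    BinaryForm.N_A_zero, BinaryForm.N_A_fifteen, BinaryForm.N_A_neg_five⟩
  · obtain ⟨t, ht⟩ := BinaryForm.exists_similar_A_of_N_eq_two hN
    refine ⟨t, ?_, ht⟩
    rw [ht.N_eq] at hN
    rintro (rfl | rfl | rfl | rfl | rfl)
    · rw [BinaryForm.N_A_three] at hN; norm_num at hN
    · rw [BinaryForm.N_A_neg_one] at hN; norm_num at hN
    · rw [BinaryForm.N_A_zero] at hN; norm_num at hN
    · rw [BinaryForm.N_A_fifteen] at hN; norm_num at hN
    · rw [BinaryForm.N_A_neg_five] at hN; norm_num at hN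
  · rintro ⟨t, ht, hs⟩
    rw [hs.N_eq, BinaryForm.N_A_eq_two ht]
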